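/- Let $\Delta\ge 3$ be an integer and $\lambda>0$. Write $\lambda_c(\mathbb{T}_\Delta)=(\Delta-1)^{\Delta-1}/(\Delta-2)^{\Delta}$. For $0\le x<1$ let $\phi(x)=(1-x)\bigl(1-\bigl(\tfrac{x}{\lambda(1-x)}\bigr)^{1/\Delta}\bigr)$, and let $\lambda_{1/2}(\mathbb{T}_\Delta)$ be the smallest $\lambda>0$ for which $\phi(1/2)\ge 0$ and $\phi(\phi(1/2))=1/2$ (this minimum exists). Let $T_\ell$ be the ball of radius $\ell$ around a vertex, the root, of the infinite $\Delta$-regular tree. Let $p_\ell$ be the probability that the root is occupied in the hard-core model on $T_\ell$ with activity $\lambda$, in which an independent set $I$ has probability proportional to $\lambda^{|I|}$. Put $p^+=\lim_{\ell\to\infty}p_{2\ell}$ and $p^-=\lim_{\ell\to\infty}p_{2\ell+1}$. With $H(x)=-x\ln x-(1-x)\ln(1-x)$ and $H_1(x,y)=-x(\ln x-\ln y)+(x-y)(\ln(y-x)-\ln y)$ (where $0\ln 0=0$), let \[ \begin{aligned} \Phi_2(\alpha,\beta,\gamma,\delta,\varepsilon)={}&2(\alpha+\beta)\ln\lambda+H(\alpha)+H_1(\gamma,\alpha)+H_1(\alpha-\gamma,1-\alpha)+H(\beta)+H_1(\delta,\beta)+H_1(\beta-\delta,1-\beta)\\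 &+\Delta\bigl(H_1(\gamma,1-2\beta+\delta)-H(\gamma)+H_1(\varepsilon,1-2\beta+\delta-\gamma)+H_1(\alpha-\gamma-\varepsilon,\beta-\delta)\\ &\qquad-H_1(\alpha-\gamma,1-\gamma)+H_1(\alpha-\gamma,1-\beta-\gamma-\varepsilon)-H_1(\alpha-\gamma,1-\alpha)\bigr), \end{aligned} \] and, for given $(\alpha,\beta)$, let the feasible region be the set of all $(\gamma,\delta,\varepsilon)\in\mathbb{R}^3$ with \[ \gamma,\delta,\varepsilon\ge 0,\quad \alpha-\gamma-\varepsilon\ge 0,\quad \beta-\delta\ge 0,\quad 1-2\beta+\delta-\gamma-\varepsilon\ge 0,\quad 1-\alpha-\beta-\varepsilon\ge 0,\quad \beta-\delta+\varepsilon+\gamma-\alpha\ge 0. \] Suppose that either $\Delta=3$ and $\lambda>\lambda_c(\mathbb{T}_3)$, or $\Delta>3$ and $\lambda\in(\lambda_c(\mathbb{T}_\Delta),\lambda_{1/2}(\mathbb{T}_\Delta)]$. Then the limits $p^+$ and $p^-$ exist, and there is a constant $\chi>0$ such that for all real $\alpha,\beta$ with $|p^+-\alpha|<\chi$ and $|p^--\beta|<\chi$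 the function $(\gamma,\delta,\varepsilon)\mapsto\Phi_2(\alpha,\beta,\gamma,\delta,\varepsilon)$ attains its unique maximum over the feasible region at the point $(\alpha^2,\beta^2,\alpha(1-\alpha-\beta))$. -/

import Mathlib

open Filter Topology

noncomputable section

namespace HardCore

/-! ### The hard-core model on a finite graph -/

open Classical in
/-- The partition function: the sum of `lam ^ |I|` over the independent sets `I` of `G`. -/
def partitionFunction {V : Type} [Fintype V] (G : SimpleGraph V) (lam : ℝ) : ℝ :=
  ∑ I ∈ Finset.univ.filter (fun I : Finset V => G.IsIndepSet (I : Set V)), lam ^ I.card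

open Classical in
/-- The probability that `v` is occupied in the Gibbs distribution, in which an independent
set `I` of `G` has probability proportional to `lam ^ |I|`. -/
def marginal {V : Type} [Fintype V] (G : SimpleGraph V) (lam : ℝ) (v : V) : ℝ :=
  (∑ I ∈ Finset.univ.filter (fun I : Finset V => G.IsIndepSet (I : Set V) ∧ v ∈ I),
    lam ^ I.card) / partitionFunction G lam

/-! ### Complete trees -/

/-- A finite graph with a distinguished vertex. -/
structure RootedGraph where
  V : Type
  fin : Fintype V
  graph : SimpleGraph V
  root : V

/-- The one-vertex rooted graph. -/
def RootedGraph.single : RootedGraph := ⟨Unit, inferInstance, ⊥, ()⟩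

/-- Adjacency in the graph made of `b` disjoint copies of `T` and of a new root `none`, which is
joined by an edge to the root of each of the copies. -/
def RootedGraph.graftAdj (b : ℕ) (T : RootedGraph) :
    Option (Fin b × T.V) → Option (Fin b × T.V) → Prop
  | none, none => False
  | none, some (_, w) => w = T.root
  | some (_, v), none => v = T.root
  | some (i, v), some (j, w) => i = j ∧ T.graph.Adj v w

/-- The rooted graph made of a new root joined to the roots of `b` disjoint copies of `T`. -/
def RootedGraph.graft (b : ℕ) (T : RootedGraph) : RootedGraph where
  V := Option (Fin b × T.V)
  fin := by
    haveI := T.fin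
    infer_instance
  graph :=
    { Adj := RootedGraph.graftAdj b T
      symm := ⟨by
        rintro (_ | ⟨i, v⟩) (_ | ⟨j, w⟩) h
        · exact h
        · exact h
        · exact h
        · exact ⟨h.1.symm, h.2.symm⟩⟩
      loopless := ⟨by
        rintro (_ | ⟨i, v⟩) h
        · exact h
        · exact T.graph.loopless.irrefl v h.2⟩ }
  root := none

/-- The complete `b`-ary tree of depth `l`: every vertex at distance less than `l` from the root
has exactly `b` children. -/
def aryTree (b : ℕ) : ℕ → RootedGraph
  | 0 => RootedGraph.single
  | l + 1 => RootedGraph.graft b (aryTree b l)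

/-- The complete tree of degree `D` with `l` levels below the root, that is, the ball of
radius `l` in the infinite `D`-regular tree: the root has `D` children and every other vertex
at distance less than `l` from the root has `D - 1` children. -/
def completeTree (D : ℕ) : ℕ → RootedGraph
  | 0 => RootedGraph.single
  | l + 1 => RootedGraph.graft D (aryTree (D - 1) l)

/-- The probability that the root is occupied in the hard-core model on `completeTree D l`. -/
def rootMarginal (D : ℕ) (lam : ℝ) (l : ℕ) : ℝ :=
  haveI := (completeTree D l).fin
  marginal (completeTree D l).graph lam (completeTree D l).root

/-! ### The activities `λ_c` and `λ_{1/2}` -/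

/-- `λ_c(𝕋_D) = (D - 1)^(D - 1) / (D - 2)^D`. -/
def lambdaC (D : ℕ) : ℝ := ((D : ℝ) - 1) ^ (D - 1) / ((D : ℝ) - 2) ^ D

/-- The function `φ(x) = (1 - x) (1 - (x / (λ (1 - x)))^(1/D))`, meant for `0 ≤ x < 1`. -/
def phi (D : ℕ) (lam x : ℝ) : ℝ :=
  (1 - x) * (1 - (x / (lam * (1 - x))) ^ (1 / (D : ℝ)))

/-- The activities `λ > 0` with `φ(φ(1/2)) = 1/2`. The condition `0 ≤ φ(1/2)` says that `φ(1/2)`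
lies in the domain `[0, 1)` of `φ` (that `φ(1/2) < 1` is automatic). -/
def halfActivities (D : ℕ) : Set ℝ :=
  {lam | 0 < lam ∧ 0 ≤ phi D lam (1 / 2) ∧ phi D lam (phi D lam (1 / 2)) = 1 / 2}

/-- `λ_{1/2}(𝕋_D)`, the smallest activity with `φ(φ(1/2)) = 1/2`; see `isLeast_lambdaHalf`. -/
def lambdaHalf (D : ℕ) : ℝ := sInf (halfActivities D)

theorem phi_half (D : ℕ) (lam : ℝ) :
    phi D lam (1 / 2) = 1 / 2 * (1 - (1 / lam) ^ (1 / (D : ℝ))) := by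
  have h : (1 / 2 : ℝ) / (lam * (1 - 1 / 2)) = 1 / lam := by
    rw [show lam * (1 - 1 / 2 : ℝ) = lam / 2 by ring, div_div_div_cancel_right₀ two_ne_zero]
  rw [phi, h]
  norm_num

theorem phi_half_nonneg_iff {D : ℕ} (hD : 3 ≤ D) {lam : ℝ} (hl : 0 < lam) :
    0 ≤ phi D lam (1 / 2) ↔ 1 ≤ lam := by
  have hp : (0 : ℝ) < 1 / (D : ℝ) := by positivity
  rw [phi_half]
  have h1 : 0 ≤ 1 / 2 * (1 - (1 / lam) ^ (1 / (D : ℝ))) ↔ (1 / lam) ^ (1 / (D : ℝ)) ≤ 1 := by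
    constructor <;> intro h <;> linarith
  rw [h1, Real.rpow_le_one_iff_of_pos (by positivity)]
  constructor
  · rintro (⟨h, h'⟩ | ⟨h, h'⟩)
    · linarith
    · exact (div_le_one hl).1 h
  · intro h
    exact Or.inr ⟨(div_le_one hl).2 h, hp.le⟩

theorem halfActivities_eq {D : ℕ} (hD : 3 ≤ D) :
    halfActivities D = Set.Ici 1 ∩ (fun l => phi D l (phi D l (1 / 2))) ⁻¹' {1 / 2} := by
  ext l
  simp only [halfActivities, Set.mem_ofPred_eq, Set.mem_inter_iff, Set.mem_Ici, Set.mem_preimage,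
    Set.mem_singleton_iff]
  constructor
  · rintro ⟨h0, h1, h2⟩
    exact ⟨(phi_half_nonneg_iff hD h0).1 h1, h2⟩
  · rintro ⟨h1, h2⟩
    have h0 : 0 < l := by linarith
    exact ⟨h0, (phi_half_nonneg_iff hD h0).2 h1, h2⟩

theorem continuousOn_phi_phi_half {D : ℕ} (hD : 3 ≤ D) :
    ContinuousOn (fun l => phi D l (phi D l (1 / 2))) (Set.Ici 1) := by
  have hp : (0 : ℝ) ≤ 1 / (D : ℝ) := by positivity
  have h1 : ContinuousOn (fun l => phi D l (1 / 2)) (Set.Ici 1) := by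
    simp only [phi_half]
    refine continuousOn_const.mul (continuousOn_const.sub
      ((continuousOn_const.div continuousOn_id ?_).rpow_const fun _ _ => Or.inr hp))
    intro l hl
    exact (lt_of_lt_of_le one_pos hl).ne'
  have h2 : ContinuousOn (fun l => 1 - phi D l (1 / 2)) (Set.Ici 1) := continuousOn_const.sub h1
  simp only [phi] at h1 h2 ⊢
  refine h2.mul (continuousOn_const.sub
    ((h1.div (continuousOn_id.mul h2) ?_).rpow_const fun _ _ => Or.inr hp))
  intro l hl
  have hl' : (0 : ℝ) < l := lt_of_lt_of_le one_pos hl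
  have : phi D l (1 / 2) < 1 := by
    rw [phi_half]
    have : 0 ≤ (1 / l) ^ (1 / (D : ℝ)) := by positivity
    linarith
  rw [phi] at this
  exact mul_ne_zero hl'.ne' (sub_pos.2 this).ne'

theorem halfActivities_nonempty {D : ℕ} (hD : 3 ≤ D) : (halfActivities D).Nonempty := by
  have hD0 : (D : ℝ) ≠ 0 := by positivity
  have hpow : ∀ x : ℝ, 0 ≤ x → (x ^ D) ^ (1 / (D : ℝ)) = x := fun x hx => by
    rw [one_div, Real.pow_rpow_inv_natCast hx (by omega)]
  have h1 : phi D 1 (phi D 1 (1 / 2)) = 1 := by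
    rw [phi_half]
    simp [phi, Real.zero_rpow (inv_ne_zero hD0)]
  have h2 : phi D (2 ^ D) (phi D (2 ^ D) (1 / 2)) ≤ 1 / 2 := by
    have e : phi D (2 ^ D) (1 / 2) = 1 / 4 := by
      rw [phi_half, show (1 : ℝ) / 2 ^ D = (1 / 2) ^ D by rw [one_div_pow], hpow _ (by norm_num)]
      norm_num
    rw [e, phi]
    have hx : (2 / 3 : ℝ) ^ D ≤ 1 / 3 := by
      have := pow_le_pow_of_le_one (show (0 : ℝ) ≤ 2 / 3 by norm_num) (by norm_num) hD
      norm_num at this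
      linarith
    have hy : (1 / 3 : ℝ) ≤ (1 / 4 / (2 ^ D * (1 - 1 / 4))) ^ (1 / (D : ℝ)) := by
      rw [← hpow (1 / 3) (by norm_num)]
      refine Real.rpow_le_rpow (by positivity) ?_ (by positivity)
      rw [show (1 / 4 : ℝ) / (2 ^ D * (1 - 1 / 4)) = 1 / 3 * (1 / 2) ^ D by
        rw [one_div_pow]; field_simp; norm_num]
      calc (1 / 3 : ℝ) ^ D = (2 / 3) ^ D * (1 / 2) ^ D := by rw [← mul_pow]; norm_num
        _ ≤ 1 / 3 * (1 / 2) ^ D := by gcongr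
    linarith
  have hle : (1 : ℝ) ≤ 2 ^ D := one_le_pow₀ (by norm_num)
  obtain ⟨l, hl, hl'⟩ := intermediate_value_Icc' hle
    ((continuousOn_phi_phi_half hD).mono Set.Icc_subset_Ici_self)
    (show (1 / 2 : ℝ) ∈ Set.Icc _ _ from ⟨h2, by rw [h1]; norm_num⟩)
  rw [halfActivities_eq hD]
  exact ⟨l, hl.1, hl'⟩

/-- The infimum in the definition of `lambdaHalf` is a minimum. -/
theorem isLeast_lambdaHalf {D : ℕ} (hD : 3 ≤ D) : IsLeast (halfActivities D) (lambdaHalf D) := by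
  have hb : BddBelow (halfActivities D) := ⟨0, fun l hl => hl.1.le⟩
  have hc : IsClosed (halfActivities D) := by
    rw [halfActivities_eq hD]
    exact (continuousOn_phi_phi_half hD).preimage_isClosed_of_isClosed isClosed_Ici
      isClosed_singleton
  exact ⟨hc.csInf_mem (halfActivities_nonempty hD) hb, fun l hl => csInf_le hb hl⟩

/-! ### The second moment exponent -/

/-- The entropy function (with `0 ln 0 = 0`). -/
def H (x : ℝ) : ℝ := -x * Real.log x - (1 - x) * Real.log (1 - x)

/-- The two-variable entropy function, for `0 ≤ x ≤ y` (with `0 ln 0 = 0`). -/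
def H₁ (x y : ℝ) : ℝ :=
  -x * (Real.log x - Real.log y) + (x - y) * (Real.log (y - x) - Real.log y)

/-- The exponent `Φ₂(α, β, γ, δ, ε)` of the second moment. -/
def Phi₂ (D : ℕ) (lam α β γ δ ε : ℝ) : ℝ :=
  2 * (α + β) * Real.log lam + H α + H₁ γ α + H₁ (α - γ) (1 - α) + H β + H₁ δ β
    + H₁ (β - δ) (1 - β)
    + D * (H₁ γ (1 - 2 * β + δ) - H γ + H₁ ε (1 - 2 * β + δ - γ)
        + H₁ (α - γ - ε) (β - δ) - H₁ (α - γ) (1 - γ) + H₁ (α - γ) (1 - β - γ - ε)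
        - H₁ (α - γ) (1 - α))

/-- The feasible region for `(γ, δ, ε)`, given `(α, β)`. -/
def feasible (α β : ℝ) : Set (ℝ × ℝ × ℝ) :=
  {x | match x with
    | (γ, δ, ε) =>
      0 ≤ γ ∧ 0 ≤ δ ∧ 0 ≤ ε ∧ 0 ≤ α - γ - ε ∧ 0 ≤ β - δ ∧ 0 ≤ 1 - 2 * β + δ - γ - ε ∧
        0 ≤ 1 - α - β - ε ∧ 0 ≤ β - δ + ε + γ - α}

/-- `x` is the unique maximum of `g` over the set `S`. -/
def IsUniqueMaxOn {X : Type*} (g : X → ℝ) (S : Set X) (x : X) : Prop :=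
  x ∈ S ∧ ∀ y ∈ S, y ≠ x → g y < g x

/-- The second moment condition for degree `D` and activity `lam`: with `p⁺` and `p⁻` the limits
of the occupation probabilities of the root of the trees of even and of odd depth,
for all `(α, β)` near `(p⁺, p⁻)` the function `Φ₂(α, β, ·, ·, ·)` has its unique maximum over
the feasible region at `(α², β², α (1 - α - β))`. -/
def SlyCondition (D : ℕ) (lam : ℝ) : Prop :=
  ∃ pPlus pMinus : ℝ,
    Tendsto (fun l : ℕ => rootMarginal D lam (2 * l)) atTop (𝓝 pPlus) ∧
    Tendsto (fun l : ℕ => rootMarginal D lam (2 * l + 1)) atTop (𝓝 pMinus) ∧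
    ∃ χ : ℝ, 0 < χ ∧ ∀ α β : ℝ, |pPlus - α| < χ → |pMinus - β| < χ →
      IsUniqueMaxOn (fun x : ℝ × ℝ × ℝ => Phi₂ D lam α β x.1 x.2.1 x.2.2) (feasible α β)
        (α ^ 2, β ^ 2, α * (1 - α - β))

end HardCore

end

open Filter Topology

noncomputable section

namespace HardCore

/-! ### The recursion on trees -/

/-! Put d = Δ - 1 and s = d/(d+1). The odds of occupation of the root of the d-ary tree converge
along even and odd depths to x > y with λ = x(1+y)^d = y(1+x)^d, and p⁺ = x/(1+x+y), p⁻ = y/(1+x+y).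
The solution r of λ = r(1+r)^d lies strictly between y and x.

A feasible point describes a coupling of two copies of the edge measure, which gives the states
(1,0), (0,1), (0,0) of an edge the weights α, β, 1-α-β. After one parameter that `Phi₂` has already
optimised is restored (`exists_product_coupling`), `Phi₂` minus its value at the product point is
d+1 times the sum of c ln(Q/c) over nine cells. Here c is the mass of a cell, and Q is its product
weight times the s-th powers of the densities of the types of its two ends. By Gibbs' inequality
this is at most (d+1)(ΣQ - 1). Each copy has the prescribed marginals, so conditioning on the edge
state in one copy makes ΣQ an average of three quantities E[ξ^s η^s] for a single edge, each at most
1 by hypercontractivity (`HyperBound`). Strict concavity of t^s gives uniqueness.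

For a single edge, Hölder's inequality eliminates η and leaves the one-variable function `profile`.
Above 1 its slope has the sign of `logGap`, whose own slope has the sign of the concave function
`gapSlope`. When both activities are λ, `logGap` vanishes at 1+y and 1+r, and λ > λ_c makes
`gapSlope` positive at 1+r. This fixes all signs, so 1+y maximises `profile` on [0, 1+r]; ratios
above 1+r are brought into this range by exchanging the two sides of the edge.

For (α,β) merely near (p⁺,p⁻) the two activities differ and the exchange is lost. The calculus still
covers ratios up to some c > 1+y, which suffices near the product point; elsewhere the strict
inequality at (p⁺,p⁻) persists by continuity and compactness. -/

open Classical in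
/-- The part of the partition function of `T` with the root occupied. -/
def RootedGraph.zIn (T : RootedGraph) (lam : ℝ) : ℝ :=
  haveI := T.fin
  ∑ I ∈ Finset.univ.filter (fun I : Finset T.V => T.graph.IsIndepSet (I : Set T.V) ∧ T.root ∈ I),
    lam ^ I.card

open Classical in
/-- The part of the partition function of `T` with the root unoccupied. -/
def RootedGraph.zOut (T : RootedGraph) (lam : ℝ) : ℝ :=
  haveI := T.fin
  ∑ I ∈ Finset.univ.filter (fun I : Finset T.V => T.graph.IsIndepSet (I : Set T.V) ∧ T.root ∉ I),
    lam ^ I.card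

open Classical in
theorem partitionFunction_eq_zIn_add_zOut (T : RootedGraph) (lam : ℝ) :
    (haveI := T.fin; partitionFunction T.graph lam) = T.zIn lam + T.zOut lam := by
  have := T.fin
  simp only [partitionFunction, RootedGraph.zIn, RootedGraph.zOut, ← Finset.filter_filter]
  exact (Finset.sum_filter_add_sum_filter_not _ _ _).symm

theorem RootedGraph.zOut_pos (T : RootedGraph) {lam : ℝ} (hl : 0 < lam) : 0 < T.zOut lam := by
  classical
  have := T.fin
  refine Finset.sum_pos (fun I _ => by positivity) ⟨∅, ?_⟩
  simp [SimpleGraph.IsIndepSet]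

/-- The family of the traces of a set of vertices of `graft b T` on the copies of `T`. -/
def graftTrace {b : ℕ} {V : Type} [Fintype V] [DecidableEq V]
    (I : Finset (Option (Fin b × V))) (k : Fin b) : Finset V :=
  Finset.univ.filter fun v => some (k, v) ∈ I

/-- The set of vertices of `graft b T` without the root that has given traces. -/
def graftUnion {b : ℕ} {V : Type} [Fintype V] [DecidableEq V]
    (p : Fin b → Finset V) : Finset (Option (Fin b × V)) :=
  (Finset.univ.filter fun x : Fin b × V => x.2 ∈ p x.1).map Function.Embedding.some

/-- The set of vertices of `graft b T` with the root that has given traces. -/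
def graftUnionRoot {b : ℕ} {V : Type} [Fintype V] [DecidableEq V]
    (p : Fin b → Finset V) : Finset (Option (Fin b × V)) :=
  insert none (graftUnion p)

section
variable {b : ℕ} {V : Type} [Fintype V] [DecidableEq V]

theorem mem_graftTrace {I : Finset (Option (Fin b × V))} {k : Fin b} {v : V} :
    v ∈ graftTrace I k ↔ some (k, v) ∈ I := by simp [graftTrace]

theorem some_mem_graftUnion {p : Fin b → Finset V} {k : Fin b} {v : V} :
    some (k, v) ∈ graftUnion p ↔ v ∈ p k := by simp [graftUnion]

theorem none_notMem_graftUnion {p : Fin b → Finset V} : none ∉ graftUnion p := by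
  simp [graftUnion]

theorem card_graftUnion (p : Fin b → Finset V) : (graftUnion p).card = ∑ k, (p k).card := by
  rw [graftUnion, Finset.card_map, Finset.card_filter, Fintype.sum_prod_type]
  refine Finset.sum_congr rfl fun k _ => ?_
  simp

theorem graftTrace_graftUnion (p : Fin b → Finset V) : graftTrace (graftUnion p) = p := by
  ext k v
  rw [mem_graftTrace, some_mem_graftUnion]

theorem graftTrace_graftUnionRoot (p : Fin b → Finset V) : graftTrace (graftUnionRoot p) = p := by
  ext k v
  simp [mem_graftTrace, graftUnionRoot, some_mem_graftUnion]

theorem card_graftUnionRoot (p : Fin b → Finset V) :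
    (graftUnionRoot p).card = (graftUnion p).card + 1 :=
  Finset.card_insert_of_notMem none_notMem_graftUnion

theorem none_mem_graftUnionRoot {p : Fin b → Finset V} : none ∈ graftUnionRoot p :=
  Finset.mem_insert_self _ _

theorem graftUnion_graftTrace {I : Finset (Option (Fin b × V))} (h : none ∉ I) :
    graftUnion (graftTrace I) = I := by
  ext (_ | ⟨k, v⟩)
  · simp [h, none_notMem_graftUnion]
  · rw [some_mem_graftUnion, mem_graftTrace]

theorem graftUnionRoot_graftTrace {I : Finset (Option (Fin b × V))} (h : none ∈ I) :
    graftUnionRoot (graftTrace I) = I := by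
  ext (_ | ⟨k, v⟩)
  · simp [h, none_mem_graftUnionRoot]
  · simp [graftUnionRoot, some_mem_graftUnion, mem_graftTrace]

end

/-- The only edges between the root and the copies go to the roots of the copies, so the traces are
independent of one another once the state of the root is fixed. This is what makes both parts of the
partition function b-th powers. -/
theorem isIndepSet_graft_iff (b : ℕ) (T : RootedGraph) [Fintype T.V] [DecidableEq T.V]
    (I : Finset (Option (Fin b × T.V))) :
    (RootedGraph.graft b T).graph.IsIndepSet (I : Set (Option (Fin b × T.V))) ↔
      (∀ k, T.graph.IsIndepSet (graftTrace I k : Set T.V)) ∧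
        (none ∈ I → ∀ k, T.root ∉ graftTrace I k) := by
  simp only [SimpleGraph.IsIndepSet, Set.Pairwise, Finset.mem_coe, mem_graftTrace]
  constructor
  · intro h
    refine ⟨fun k v hv w hw hvw ha => ?_, fun hn k hk => ?_⟩
    · exact h hv hw (fun e => hvw (congrArg Prod.snd (Option.some.inj e))) ⟨rfl, ha⟩
    · exact h hn hk (fun e => Option.some_ne_none _ e.symm) rfl
  · rintro ⟨h1, h2⟩ (_ | ⟨i, v⟩) hv (_ | ⟨j, w⟩) hw hvw ha
    · exact hvw rfl
    · have ha' : w = T.root := ha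
      subst ha'
      exact h2 hv _ hw
    · have ha' : v = T.root := ha
      subst ha'
      exact h2 hw _ hv
    · obtain ⟨rfl, ha'⟩ : i = j ∧ T.graph.Adj v w := ha
      exact h1 i hv hw ha'.ne ha'

theorem sum_pow_card_pow {b : ℕ} {V : Type} [Fintype V] [DecidableEq V] (S : Finset (Finset V))
    (lam : ℝ) : (∑ J ∈ S, lam ^ J.card) ^ b =
      ∑ p ∈ Fintype.piFinset fun _ : Fin b => S, lam ^ (graftUnion p).card := by
  have h : ∏ _k : Fin b, ∑ J ∈ S, lam ^ J.card = (∑ J ∈ S, lam ^ J.card) ^ b := by simp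
  rw [← h, Finset.prod_univ_sum]
  refine Finset.sum_congr rfl fun p _ => ?_
  rw [Finset.prod_pow_eq_pow_sum, card_graftUnion]

theorem RootedGraph.zOut_graft (b : ℕ) (T : RootedGraph) (lam : ℝ) :
    (RootedGraph.graft b T).zOut lam = (T.zIn lam + T.zOut lam) ^ b := by
  classical
  let _ := T.fin
  let _ := (RootedGraph.graft b T).fin
  rw [← partitionFunction_eq_zIn_add_zOut, partitionFunction, sum_pow_card_pow, RootedGraph.zOut]
  symm
  refine Finset.sum_nbij' (fun p : Fin b → Finset T.V => graftUnion p)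
    (fun I : Finset (Option (Fin b × T.V)) => graftTrace I) ?_ ?_ ?_ ?_ ?_
  · intro p hp
    simp only [Fintype.mem_piFinset, Finset.mem_filter, Finset.mem_univ, true_and] at hp
    refine Finset.mem_filter.2 ⟨Finset.mem_univ _, (isIndepSet_graft_iff b T _).2 ?_,
      none_notMem_graftUnion⟩
    rw [graftTrace_graftUnion]
    exact ⟨hp, fun h => absurd h none_notMem_graftUnion⟩
  · intro I hI
    have hI' := (isIndepSet_graft_iff b T I).1 (Finset.mem_filter.1 hI).2.1
    simpa [Fintype.mem_piFinset] using hI'.1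
  · intro p _
    exact graftTrace_graftUnion p
  · intro I hI
    exact graftUnion_graftTrace (Finset.mem_filter.1 hI).2.2
  · intro p _
    rfl

theorem RootedGraph.zIn_graft (b : ℕ) (T : RootedGraph) (lam : ℝ) :
    (RootedGraph.graft b T).zIn lam = lam * T.zOut lam ^ b := by
  classical
  let _ := T.fin
  let _ := (RootedGraph.graft b T).fin
  rw [RootedGraph.zOut, sum_pow_card_pow, RootedGraph.zIn, Finset.mul_sum]
  symm
  refine Finset.sum_nbij' (fun p : Fin b → Finset T.V => graftUnionRoot p)
    (fun I : Finset (Option (Fin b × T.V)) => graftTrace I) ?_ ?_ ?_ ?_ ?_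
  · intro p hp
    simp only [Fintype.mem_piFinset, Finset.mem_filter, Finset.mem_univ, true_and] at hp
    refine Finset.mem_filter.2 ⟨Finset.mem_univ _, (isIndepSet_graft_iff b T _).2 ?_,
      none_mem_graftUnionRoot⟩
    rw [graftTrace_graftUnionRoot]
    exact ⟨fun k => (hp k).1, fun _ k => (hp k).2⟩
  · intro I hI
    have hI' := (isIndepSet_graft_iff b T I).1 (Finset.mem_filter.1 hI).2.1
    have := hI'.2 (Finset.mem_filter.1 hI).2.2
    simp only [Fintype.mem_piFinset, Finset.mem_filter, Finset.mem_univ, true_and]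
    exact fun k => ⟨hI'.1 k, this k⟩
  · intro p _
    exact graftTrace_graftUnionRoot p
  · intro I hI
    exact graftUnionRoot_graftTrace (Finset.mem_filter.1 hI).2.2
  · intro p _
    exact (pow_succ' lam _).symm.trans (congrArg (lam ^ ·) (card_graftUnionRoot p).symm)

/-- The odds of occupation of the root of the complete `b`-ary tree. -/
def odds (b : ℕ) (lam : ℝ) : ℕ → ℝ
  | 0 => lam
  | n + 1 => lam / (1 + odds b lam n) ^ b

theorem zIn_graft_eq {T : RootedGraph} {lam r : ℝ} (b : ℕ) (hl : 0 < lam)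
    (h : T.zIn lam = r * T.zOut lam) (hr : 0 < 1 + r) :
    (RootedGraph.graft b T).zIn lam =
      lam / (1 + r) ^ b * (RootedGraph.graft b T).zOut lam := by
  have := T.zOut_pos hl
  rw [RootedGraph.zIn_graft, RootedGraph.zOut_graft, h,
    show r * T.zOut lam + T.zOut lam = (1 + r) * T.zOut lam by ring, mul_pow]
  field_simp

theorem odds_pos (b : ℕ) {lam : ℝ} (hl : 0 < lam) (n : ℕ) : 0 < odds b lam n := by
  induction n with
  | zero => exact hl
  | succ n ih => rw [odds]; positivity

theorem zIn_aryTree (b : ℕ) {lam : ℝ} (hl : 0 < lam) (n : ℕ) :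
    (aryTree b n).zIn lam = odds b lam n * (aryTree b n).zOut lam := by
  induction n with
  | zero =>
    have h1 : RootedGraph.single.zIn lam = lam := by
      refine (Finset.sum_eq_single_of_mem ({()} : Finset Unit) ?_ ?_).trans ?_
      · refine (@Finset.mem_filter ..).2 ⟨Finset.mem_univ _,
          fun v _ w _ h => absurd (Subsingleton.elim (α := Unit) v w) h, Finset.mem_singleton_self ()⟩
      · intro I hI hne
        have hI' := (@Finset.mem_filter ..).1 hI
        refine absurd ?_ hne
        ext ⟨⟩
        exact iff_of_true hI'.2.2 (Finset.mem_singleton_self _)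
      · exact pow_one lam
    have h2 : RootedGraph.single.zOut lam = 1 := by
      refine (Finset.sum_eq_single_of_mem (∅ : Finset Unit) ?_ ?_).trans ?_
      · refine (@Finset.mem_filter ..).2 ⟨Finset.mem_univ _,
          fun v _ w _ h => absurd (Subsingleton.elim (α := Unit) v w) h, Finset.notMem_empty ()⟩
      · intro I hI hne
        have hI' := (@Finset.mem_filter ..).1 hI
        refine absurd ?_ hne
        ext ⟨⟩
        exact iff_of_false hI'.2.2 (Finset.notMem_empty _)
      · exact pow_zero lam
    rw [aryTree, h1, h2, odds, mul_one]
  | succ n ih =>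
    exact zIn_graft_eq b hl ih (by linarith [odds_pos b hl n])

theorem rootMarginal_succ (D : ℕ) {lam : ℝ} (hl : 0 < lam) (n : ℕ) :
    rootMarginal D lam (n + 1) =
      lam / (1 + odds (D - 1) lam n) ^ D / (1 + lam / (1 + odds (D - 1) lam n) ^ D) := by
  have h := zIn_graft_eq D hl (zIn_aryTree (D - 1) hl n) (by linarith [odds_pos (D - 1) hl n])
  have h0 := (completeTree D (n + 1)).zOut_pos hl
  have hp := odds_pos (D - 1) hl n
  change (completeTree D (n + 1)).zIn lam / (haveI := (completeTree D (n + 1)).fin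
    partitionFunction (completeTree D (n + 1)).graph lam) = _
  rw [partitionFunction_eq_zIn_add_zOut]
  change (completeTree D (n + 1)).zIn lam = _ * (completeTree D (n + 1)).zOut lam at h
  rw [h]
  have : 0 < lam / (1 + odds (D - 1) lam n) ^ D := by positivity
  rw [← add_one_mul, mul_div_mul_right _ _ h0.ne', add_comm _ (1 : ℝ)]

/-! ### The one-variable optimisation -/

/-- The bilinear form whose norm governs the first moment, in homogeneous coordinates. -/
def edgeForm (d : ℕ) (l₁ l₂ A B E C : ℝ) : ℝ :=
  A ^ d * E ^ d + l₁ * (B ^ d * E ^ d) + l₂ * (A ^ d * C ^ d)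

/-- The function left after optimising over the second argument of `edgeForm`. -/
def profile (d : ℕ) (l₁ l₂ A : ℝ) : ℝ :=
  ((A ^ d + l₁) ^ (d + 1) + l₂ * (A ^ d) ^ (d + 1)) / (A ^ (d + 1) + l₁) ^ d

/-- The factor of the derivative of `profile` that determines its sign. -/
def profileSign (d : ℕ) (l₁ l₂ A : ℝ) : ℝ :=
  l₂ * A ^ (d * d) - (A - 1) * (A ^ d + l₁) ^ d

/-- The logarithm of the ratio of the two terms of `profileSign`. -/
def logGap (d : ℕ) (l₁ l₂ A : ℝ) : ℝ :=
  Real.log l₂ + (d * d : ℕ) * Real.log A - Real.log (A - 1) - d * Real.log (A ^ d + l₁)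

/-- The factor of the derivative of `logGap` that determines its sign. -/
def gapSlope (d : ℕ) (l₁ A : ℝ) : ℝ :=
  ((d : ℝ) ^ 2 - 1) * l₁ * A - (d : ℝ) ^ 2 * l₁ - A ^ (d + 1)

theorem logGap_eq_log_sub_log {d : ℕ} {l₁ l₂ A : ℝ} (h1 : 0 < l₁) (h2 : 0 < l₂) (hA : 1 < A) :
    logGap d l₁ l₂ A =
      Real.log (l₂ * A ^ (d * d)) - Real.log ((A - 1) * (A ^ d + l₁) ^ d) := by
  have hA0 : 0 < A := by linarith
  have hA1 : 0 < A - 1 := by linarith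
  have hP : 0 < A ^ d + l₁ := by positivity
  rw [Real.log_mul h2.ne' (by positivity), Real.log_mul hA1.ne' (by positivity), Real.log_pow,
    Real.log_pow, logGap]
  ring

theorem profileSign_nonneg_iff {d : ℕ} {l₁ l₂ A : ℝ} (h1 : 0 < l₁) (h2 : 0 < l₂) (hA : 1 < A) :
    0 ≤ profileSign d l₁ l₂ A ↔ 0 ≤ logGap d l₁ l₂ A := by
  have hA0 : 0 < A := by linarith
  have hA1 : 0 < A - 1 := by linarith
  have hP : 0 < A ^ d + l₁ := by positivity
  rw [logGap_eq_log_sub_log h1 h2 hA, profileSign, sub_nonneg, sub_nonneg,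
    Real.log_le_log_iff (by positivity) (by positivity)]

theorem profileSign_nonpos_iff {d : ℕ} {l₁ l₂ A : ℝ} (h1 : 0 < l₁) (h2 : 0 < l₂) (hA : 1 < A) :
    profileSign d l₁ l₂ A ≤ 0 ↔ logGap d l₁ l₂ A ≤ 0 := by
  have hA0 : 0 < A := by linarith
  have hA1 : 0 < A - 1 := by linarith
  have hP : 0 < A ^ d + l₁ := by positivity
  rw [logGap_eq_log_sub_log h1 h2 hA, profileSign, sub_nonpos, sub_nonpos,
    Real.log_le_log_iff (by positivity) (by positivity)]

theorem logGap_eq_zero_iff {d : ℕ} {l₁ l₂ A : ℝ} (h1 : 0 < l₁) (h2 : 0 < l₂) (hA : 1 < A) :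
    logGap d l₁ l₂ A = 0 ↔ profileSign d l₁ l₂ A = 0 := by
  rw [le_antisymm_iff, le_antisymm_iff, profileSign_nonneg_iff h1 h2 hA,
    profileSign_nonpos_iff h1 h2 hA]

theorem hasDerivAt_logGap {d : ℕ} (hd : 1 ≤ d) {l₁ l₂ A : ℝ} (h1 : 0 < l₁) (hA : 1 < A) :
    HasDerivAt (logGap d l₁ l₂) (gapSlope d l₁ A / (A * (A - 1) * (A ^ d + l₁))) A := by
  have hA0 : 0 < A := by linarith
  have hA1 : 0 < A - 1 := by linarith
  have hP : 0 < A ^ d + l₁ := by positivity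
  obtain ⟨k, rfl⟩ : ∃ k, d = k + 1 := ⟨d - 1, by omega⟩
  have e1 := (Real.hasDerivAt_log hA0.ne').const_mul (((k + 1) * (k + 1) : ℕ) : ℝ)
  have e2 := ((hasDerivAt_id A).sub_const 1).log hA1.ne'
  have e3 := (((hasDerivAt_pow (k + 1) A).add_const l₁).log hP.ne').const_mul ((k + 1 : ℕ) : ℝ)
  refine (((e1.const_add (Real.log l₂)).sub e2).sub e3).congr_deriv ?_
  simp only [gapSlope, id]
  push_cast
  field_simp
  ring

theorem hasDerivAt_profile {d : ℕ} (hd : 1 ≤ d) {l₁ l₂ A : ℝ} (h1 : 0 < l₁) (hA : 0 ≤ A) :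
    HasDerivAt (profile d l₁ l₂)
      (d * (d + 1) * A ^ (d - 1) * l₁ * profileSign d l₁ l₂ A / (A ^ (d + 1) + l₁) ^ (d + 1)) A := by
  have hM : 0 < A ^ (d + 1) + l₁ := by positivity
  obtain ⟨k, rfl⟩ : ∃ k, d = k + 1 := ⟨d - 1, by omega⟩
  have e1 := (((hasDerivAt_pow (k + 1) A).add_const l₁).pow (k + 1 + 1)).add
    (((hasDerivAt_pow (k + 1) A).pow (k + 1 + 1)).const_mul l₂)
  have e2 := ((hasDerivAt_pow (k + 1 + 1) A).add_const l₁).pow (k + 1)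
  refine (e1.div e2 (pow_pos hM _).ne').congr_deriv ?_
  simp only [profileSign, Nat.add_sub_cancel]
  rw [show A ^ ((k + 1) * (k + 1)) = (A ^ (k + 1)) ^ (k + 1) by rw [pow_mul]]
  simp only [Pi.pow_apply, Pi.add_apply]
  rw [div_eq_div_iff (by positivity) (by positivity)]
  push_cast
  rw [pow_succ A (k + 1), pow_succ (A ^ (k + 1) * A + l₁) (k + 1),
    pow_succ (A ^ (k + 1) * A + l₁) k, pow_succ (A ^ (k + 1) + l₁) (k + 1),
    pow_succ (A ^ (k + 1)) (k + 1)]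
  generalize (A ^ (k + 1) * A + l₁) ^ k = m
  generalize (A ^ (k + 1) + l₁) ^ (k + 1) = p
  generalize (A ^ (k + 1)) ^ (k + 1) = q
  rw [pow_succ A k]
  generalize A ^ k = x
  ring

/-- Concavity lets the values of `gapSlope` at two points decide its sign between them or to one
side of them; no root of it is ever computed. -/
theorem concaveOn_gapSlope (d : ℕ) (l₁ : ℝ) : ConcaveOn ℝ (Set.Ici 0) (gapSlope d l₁) := by
  have h1 : ConcaveOn ℝ (Set.Ici (0 : ℝ)) fun A : ℝ =>
      ((d : ℝ) ^ 2 - 1) * l₁ * A - (d : ℝ) ^ 2 * l₁ := by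
    refine ⟨convex_Ici 0, fun x _ y _ a b _ _ hab => ?_⟩
    simp only [smul_eq_mul]
    exact le_of_eq (by linear_combination -(d : ℝ) ^ 2 * l₁ * hab)
  exact h1.sub (convexOn_pow (d + 1))

theorem continuousOn_logGap {d : ℕ} (hd : 1 ≤ d) {l₁ l₂ : ℝ} (h1 : 0 < l₁) :
    ContinuousOn (logGap d l₁ l₂) (Set.Ioi 1) := fun _ hA =>
  (hasDerivAt_logGap hd h1 hA).continuousAt.continuousWithinAt

/-- If `gapSlope` were positive at `A` as well as at `s`, concavity would make it positive at the
intermediate point `c`. -/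
theorem gapSlope_nonpos_of_le {d : ℕ} {l₁ A c s : ℝ} (hA : 0 ≤ A) (hAc : A ≤ c) (hcs : c ≤ s)
    (hc : gapSlope d l₁ c ≤ 0) (hs : 0 < gapSlope d l₁ s) : gapSlope d l₁ A ≤ 0 := by
  have h := (concaveOn_gapSlope d l₁).min_le_of_mem_Icc (x := A) (y := s) (z := c) hA
    (hA.trans (hAc.trans hcs)) ⟨hAc, hcs⟩
  by_contra! h'
  exact absurd (lt_min h' hs) (not_lt.2 (h.trans hc))

theorem gapSlope_div_nonpos {d : ℕ} {l₁ A : ℝ} (h1 : 0 < l₁) (hA : 1 < A)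
    (h : gapSlope d l₁ A ≤ 0) : gapSlope d l₁ A / (A * (A - 1) * (A ^ d + l₁)) ≤ 0 := by
  have : 0 < A - 1 := by linarith
  exact div_nonpos_of_nonpos_of_nonneg h (by positivity)

theorem gapSlope_div_nonneg {d : ℕ} {l₁ A : ℝ} (h1 : 0 < l₁) (hA : 1 < A)
    (h : 0 ≤ gapSlope d l₁ A) : 0 ≤ gapSlope d l₁ A / (A * (A - 1) * (A ^ d + l₁)) := by
  have : 0 < A - 1 := by linarith
  positivity

theorem antitoneOn_logGap {d : ℕ} (hd : 1 ≤ d) {l₁ l₂ c s : ℝ} (h1 : 0 < l₁) (hcs : c ≤ s)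
    (hc : gapSlope d l₁ c ≤ 0) (hs : 0 < gapSlope d l₁ s) :
    AntitoneOn (logGap d l₁ l₂) (Set.Ioc 1 c) := by
  refine antitoneOn_of_deriv_nonpos (convex_Ioc 1 c)
    ((continuousOn_logGap hd h1).mono fun x hx => hx.1) ?_ ?_
  · intro x hx
    rw [interior_Ioc] at hx
    exact (hasDerivAt_logGap hd h1 hx.1).differentiableAt.differentiableWithinAt
  · intro x hx
    rw [interior_Ioc] at hx
    rw [(hasDerivAt_logGap hd h1 hx.1).deriv]
    exact gapSlope_div_nonpos h1 hx.1
      (gapSlope_nonpos_of_le (by linarith [hx.1]) hx.2.le hcs hc hs)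

theorem monotoneOn_logGap {d : ℕ} (hd : 1 ≤ d) {l₁ l₂ c s : ℝ} (h1 : 0 < l₁) (hc1 : 1 < c)
    (hc : 0 ≤ gapSlope d l₁ c) (hs : 0 ≤ gapSlope d l₁ s) :
    MonotoneOn (logGap d l₁ l₂) (Set.Icc c s) := by
  refine monotoneOn_of_deriv_nonneg (convex_Icc c s)
    ((continuousOn_logGap hd h1).mono fun x hx => hc1.trans_le hx.1) ?_ ?_
  · intro x hx
    rw [interior_Icc] at hx
    exact (hasDerivAt_logGap hd h1 (hc1.trans hx.1)).differentiableAt.differentiableWithinAt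
  · intro x hx
    rw [interior_Icc] at hx
    rw [(hasDerivAt_logGap hd h1 (hc1.trans hx.1)).deriv]
    refine gapSlope_div_nonneg h1 (hc1.trans hx.1) ((le_min hc hs).trans
      ((concaveOn_gapSlope d l₁).min_le_of_mem_Icc ?_ ?_ ⟨hx.1.le, hx.2.le⟩))
    · exact (zero_lt_one.trans hc1).le
    · exact (zero_lt_one.trans (hc1.trans (hx.1.trans hx.2))).le

/-- Between two zeros of `logGap`, at the larger of which it increases, it is nonpositive. -/
theorem logGap_between_zeros {d : ℕ} (hd : 1 ≤ d) {l₁ l₂ A₀ s : ℝ} (h1 : 0 < l₁) (hA₀ : 1 < A₀)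
    (hAs : A₀ < s) (h0 : logGap d l₁ l₂ A₀ = 0) (h0s : logGap d l₁ l₂ s = 0)
    (hs : 0 < gapSlope d l₁ s) :
    (∃ c, A₀ < c ∧ c < s ∧ gapSlope d l₁ c = 0) ∧
      ∀ A, A₀ ≤ A → A ≤ s → logGap d l₁ l₂ A ≤ 0 := by
  obtain ⟨c, hc, hc0⟩ := exists_hasDerivAt_eq_zero hAs
    ((continuousOn_logGap hd h1).mono fun x hx => hA₀.trans_le hx.1) (h0.trans h0s.symm)
    fun x hx => hasDerivAt_logGap hd h1 (hA₀.trans hx.1)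
  have hc1 : 1 < c := hA₀.trans hc.1
  have hc1' : 0 < c - 1 := by linarith
  have hk : gapSlope d l₁ c = 0 := by
    refine (div_eq_zero_iff.1 hc0).resolve_right ?_
    have : 0 < c := by linarith
    positivity
  refine ⟨⟨c, hc.1, hc.2, hk⟩, fun A hA hA' => ?_⟩
  rcases le_total A c with h | h
  · rw [← h0]
    exact antitoneOn_logGap hd h1 hc.2.le hk.le hs ⟨hA₀, hc.1.le⟩ ⟨hA₀.trans_le hA, h⟩ hA
  · rw [← h0s]
    exact monotoneOn_logGap hd h1 hc1 hk.ge hs.le ⟨h, hA'⟩ ⟨hc.2.le, le_rfl⟩ hA'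

/-- The sign of `logGap` is that of the derivative of `profile`, which therefore rises up to `A₀`
and falls from there to `A₁`. -/
theorem profile_le {d : ℕ} (hd : 1 ≤ d) {l₁ l₂ A₀ A₁ : ℝ} (h1 : 0 < l₁) (h2 : 0 < l₂)
    (hA₀ : 1 < A₀) (hpos : ∀ A, 1 < A → A ≤ A₀ → 0 ≤ logGap d l₁ l₂ A)
    (hneg : ∀ A, A₀ ≤ A → A ≤ A₁ → logGap d l₁ l₂ A ≤ 0) {A : ℝ} (hA : 0 ≤ A) (hA' : A ≤ A₁) :
    profile d l₁ l₂ A ≤ profile d l₁ l₂ A₀ := by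
  have hder := fun x (hx : 0 ≤ x) => hasDerivAt_profile (l₂ := l₂) hd h1 hx
  have hcont : ContinuousOn (profile d l₁ l₂) (Set.Ici 0) := fun x hx =>
    (hder x hx).continuousAt.continuousWithinAt
  rcases le_total A A₀ with h | h
  · have hm : MonotoneOn (profile d l₁ l₂) (Set.Icc 0 A₀) := by
      refine monotoneOn_of_deriv_nonneg (convex_Icc 0 A₀) (hcont.mono fun x hx => hx.1) ?_ ?_
      · intro x hx
        rw [interior_Icc] at hx
        exact (hder x hx.1.le).differentiableAt.differentiableWithinAt
      · intro x hx
        rw [interior_Icc] at hx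
        have hx0 := hx.1
        rw [(hder x hx.1.le).deriv]
        have : 0 ≤ profileSign d l₁ l₂ x := by
          -- `logGap` governs the sign only above 1. At or below 1 the subtracted term of
          -- `profileSign` is not positive, so the sign is clear.
          rcases le_or_gt x 1 with hx1 | hx1
          · have : 0 ≤ (1 - x) * (x ^ d + l₁) ^ d :=
              mul_nonneg (by linarith) (by positivity)
            have : 0 < l₂ * x ^ (d * d) := by positivity
            rw [profileSign]
            linarith
          · exact (profileSign_nonneg_iff h1 h2 hx1).2 (hpos x hx1 hx.2.le)
        positivity
    exact hm ⟨hA, h⟩ ⟨by linarith, le_rfl⟩ h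
  · have hm : AntitoneOn (profile d l₁ l₂) (Set.Icc A₀ A₁) := by
      refine antitoneOn_of_deriv_nonpos (convex_Icc A₀ A₁)
        (hcont.mono fun x hx => (by linarith [hx.1] : (0 : ℝ) ≤ x)) ?_ ?_
      · intro x hx
        rw [interior_Icc] at hx
        exact (hder x (by linarith [hx.1])).differentiableAt.differentiableWithinAt
      · intro x hx
        rw [interior_Icc] at hx
        have hx0 : 0 < x := by linarith [hx.1]
        rw [(hder x hx0.le).deriv]
        have := (profileSign_nonpos_iff h1 h2 (hA₀.trans hx.1)).2 (hneg x hx.1.le hx.2.le)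
        exact div_nonpos_of_nonpos_of_nonneg
          (mul_nonpos_of_nonneg_of_nonpos (by positivity) this) (by positivity)
    exact hm ⟨le_rfl, h.trans hA'⟩ ⟨h, hA'⟩ h

/-! ### Optimising the second argument -/

/-- Hölder's inequality with two terms. -/
theorem holder_two {d : ℕ} {l P Q e c : ℝ} (hl : 0 < l) (hP : 0 ≤ P) (hQ : 0 ≤ Q) (he : 0 ≤ e)
    (hc : 0 ≤ c) : (e ^ d * P + l * (c ^ d * Q)) ^ (d + 1) ≤
      (P ^ (d + 1) + l * Q ^ (d + 1)) * (e ^ (d + 1) + l * c ^ (d + 1)) ^ d := by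
  rcases Nat.eq_zero_or_pos d with rfl | hd
  · simp
  -- The convexity argument divides by `e` and `c`, so their vanishing is treated apart.
  rcases he.eq_or_lt with rfl | he
  · rw [zero_pow hd.ne', zero_pow (by omega), zero_mul, zero_add, zero_add]
    calc (l * (c ^ d * Q)) ^ (d + 1) = l * Q ^ (d + 1) * (l * c ^ (d + 1)) ^ d := by
          simp only [mul_pow, ← pow_mul, pow_succ]
          ring
      _ ≤ _ := by
          gcongr
          linarith [pow_nonneg hP (d + 1)]
  rcases hc.eq_or_lt with rfl | hc
  · rw [zero_pow hd.ne', zero_pow (by omega), zero_mul, mul_zero, add_zero, add_zero]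
    calc (e ^ d * P) ^ (d + 1) = P ^ (d + 1) * (e ^ (d + 1)) ^ d := by
          simp only [mul_pow, ← pow_mul, pow_succ]
          ring
      _ ≤ _ := by
          gcongr
          have := pow_nonneg hQ (d + 1)
          linarith [mul_nonneg hl.le this]
  set w := e ^ (d + 1) + l * c ^ (d + 1) with hw
  have hw0 : 0 < w := by positivity
  -- Jensen's inequality for t^(d+1) at P/e and Q/c, with weights proportional to e^(d+1) and l
  -- c^(d+1).
  have hj := (convexOn_pow (d + 1)).2 (show P / e ∈ Set.Ici 0 from div_nonneg hP he.le)
    (show Q / c ∈ Set.Ici 0 from div_nonneg hQ hc.le)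
    (show 0 ≤ e ^ (d + 1) / w by positivity) (show 0 ≤ l * c ^ (d + 1) / w by positivity)
    (by rw [← add_div, ← hw, div_self hw0.ne'])
  simp only [smul_eq_mul] at hj
  have e1 : e ^ (d + 1) / w * (P / e) + l * c ^ (d + 1) / w * (Q / c) =
      (e ^ d * P + l * (c ^ d * Q)) / w := by
    rw [pow_succ, pow_succ]
    field_simp
  have e2 : e ^ (d + 1) / w * (P / e) ^ (d + 1) + l * c ^ (d + 1) / w * (Q / c) ^ (d + 1) =
      (P ^ (d + 1) + l * Q ^ (d + 1)) / w := by
    rw [div_pow, div_pow]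
    field_simp
  rw [e1, e2, div_pow, div_le_div_iff₀ (by positivity) hw0, pow_succ w] at hj
  rw [← mul_assoc (P ^ (d + 1) + l * Q ^ (d + 1))] at hj
  exact le_of_mul_le_mul_right hj hw0

/-- The form is linear in (E^d, C^d), with coefficients A^d + l₁B^d and l₂A^d, so Hölder's
inequality bounds it by the dual norm of the coefficients. -/
theorem edgeForm_pow_le {d : ℕ} {l₁ l₂ A B E C : ℝ} (h1 : 0 < l₁) (h2 : 0 < l₂) (hA : 0 ≤ A)
    (hB : 0 ≤ B) (hE : 0 ≤ E) (hC : 0 ≤ C) :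
    edgeForm d l₁ l₂ A B E C ^ (d + 1) ≤
      ((A ^ d + l₁ * B ^ d) ^ (d + 1) + l₂ * (A ^ d) ^ (d + 1)) *
        (E ^ (d + 1) + l₂ * C ^ (d + 1)) ^ d := by
  have h := holder_two (d := d) (P := A ^ d + l₁ * B ^ d) (Q := A ^ d) h2 (by positivity)
    (by positivity) hE hC
  refine (le_of_eq ?_).trans h
  rw [edgeForm]
  ring

theorem profile_homogeneous_le {d : ℕ} (hd : 1 ≤ d) {l₁ l₂ A₁ N A B : ℝ} (h1 : 0 < l₁)
    (hN : ∀ A, 0 ≤ A → A ≤ A₁ → profile d l₁ l₂ A ≤ N) (hA : 0 ≤ A) (hB : 0 ≤ B)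
    (hAB : A ≤ A₁ * B) :
    (A ^ d + l₁ * B ^ d) ^ (d + 1) + l₂ * (A ^ d) ^ (d + 1) ≤
      N * (A ^ (d + 1) + l₁ * B ^ (d + 1)) ^ d := by
  rcases hB.eq_or_lt with rfl | hB
  · have : A = 0 := by linarith
    subst this
    have h : d ≠ 0 := by omega
    simp [zero_pow h]
  have h := hN (A / B) (by positivity) ((div_le_iff₀ hB).2 hAB)
  have hpos : 0 < (A / B) ^ (d + 1) + l₁ := by positivity
  rw [profile, div_le_iff₀ (by positivity)] at h
  have h' := mul_le_mul_of_nonneg_right h (show 0 ≤ (B ^ d) ^ (d + 1) by positivity)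
  have e1 : (((A / B) ^ d + l₁) ^ (d + 1) + l₂ * ((A / B) ^ d) ^ (d + 1)) * (B ^ d) ^ (d + 1) =
      (A ^ d + l₁ * B ^ d) ^ (d + 1) + l₂ * (A ^ d) ^ (d + 1) := by
    rw [add_mul, ← mul_pow, mul_assoc, ← mul_pow, div_pow, add_mul,
      div_mul_cancel₀ _ (by positivity)]
  have e2 : N * ((A / B) ^ (d + 1) + l₁) ^ d * (B ^ d) ^ (d + 1) =
      N * (A ^ (d + 1) + l₁ * B ^ (d + 1)) ^ d := by
    rw [← pow_mul, mul_comm d (d + 1), pow_mul, mul_assoc, ← mul_pow, add_mul, div_pow,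
      div_mul_cancel₀ _ (by positivity)]
  rwa [e1, e2] at h'

theorem edgeForm_pow_le_of_profile_le {d : ℕ} (hd : 1 ≤ d) {l₁ l₂ A₁ N A B E C : ℝ} (h1 : 0 < l₁)
    (h2 : 0 < l₂) (hN : ∀ A, 0 ≤ A → A ≤ A₁ → profile d l₁ l₂ A ≤ N) (hA : 0 ≤ A) (hB : 0 ≤ B)
    (hE : 0 ≤ E) (hC : 0 ≤ C) (hAB : A ≤ A₁ * B) :
    edgeForm d l₁ l₂ A B E C ^ (d + 1) ≤
      N * (A ^ (d + 1) + l₁ * B ^ (d + 1)) ^ d * (E ^ (d + 1) + l₂ * C ^ (d + 1)) ^ d :=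
  (edgeForm_pow_le h1 h2 hA hB hE hC).trans
    (mul_le_mul_of_nonneg_right (profile_homogeneous_le hd h1 hN hA hB hAB) (by positivity))

/-- With equal activities, a bound for `A ≤ (1 + r) B` with `r` the fixed point extends to all
arguments by exchanging the two sides. -/
theorem edgeForm_pow_le_of_fixedPoint {d : ℕ} (hd : 1 ≤ d) {l r N A B E C : ℝ} (hr : 0 < r)
    (hl : l = r * (1 + r) ^ d) (hN : ∀ A, 0 ≤ A → A ≤ 1 + r → profile d l l A ≤ N)
    (hA : 0 ≤ A) (hB : 0 ≤ B) (hE : 0 ≤ E) (hC : 0 ≤ C) :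
    edgeForm d l l A B E C ^ (d + 1) ≤
      N * (A ^ (d + 1) + l * B ^ (d + 1)) ^ d * (E ^ (d + 1) + l * C ^ (d + 1)) ^ d := by
  have h0 : 0 < l := by rw [hl]; positivity
  rcases le_total A ((1 + r) * B) with h | h
  · exact edgeForm_pow_le_of_profile_le hd h0 h0 hN hA hB hE hC h
  rcases hA.eq_or_lt with rfl | hA
  · have : B = 0 := by nlinarith
    subst this
    have h : d ≠ 0 := by omega
    simp [edgeForm, zero_pow h]
  refine (edgeForm_pow_le h0 h0 hA.le hB hE hC).trans
    (mul_le_mul_of_nonneg_right ?_ (by positivity))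
  -- (P, Q) are the coefficients produced by Hölder's inequality. Their ratio P/Q is at most 1+r
  -- exactly because A/B is at least 1+r and l = r(1+r)^d.
  set P := A ^ d + l * B ^ d with hP
  set Q := A ^ d with hQ
  have hQ0 : 0 < Q := by positivity
  have hP0 : 0 < P := by positivity
  have hPQ : P ≤ (1 + r) * Q := by
    have : ((1 + r) * B) ^ d ≤ A ^ d := pow_le_pow_left₀ (by positivity) h d
    rw [mul_pow] at this
    rw [hP, hl]
    nlinarith
  have h3 := edgeForm_pow_le_of_profile_le hd h0 h0 hN hP0.le hQ0.le hA.le hB hPQ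
  -- The Hölder bound X is itself a value of the form, with (A, B) now in the second place. The
  -- bound already known gives X^(d+1) ≤ N X^d (⋯)^d, and X^d cancels.
  have e : edgeForm d l l P Q A B = P ^ (d + 1) + l * Q ^ (d + 1) := by
    rw [edgeForm, pow_succ, pow_succ]
    simp only [hP, hQ]
    ring
  rw [e] at h3
  set X := P ^ (d + 1) + l * Q ^ (d + 1) with hX
  have hX0 : 0 < X ^ d := by positivity
  rw [pow_succ', mul_right_comm] at h3
  exact le_of_mul_le_mul_right h3 hX0

/-! ### The limits of the recursion -/

/-- Any pair (x, y) determines activities for which 1+y is a critical point of `profile`; with equal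
activities this is the condition for a cycle of period two. -/
theorem profileSign_eq_zero {d : ℕ} (x y : ℝ) :
    profileSign d (x * (1 + y) ^ d) (y * (1 + x) ^ d) (1 + y) = 0 := by
  rw [profileSign, pow_mul, show (1 + y) ^ d + x * (1 + y) ^ d = (1 + y) ^ d * (1 + x) by ring,
    mul_pow]
  ring

theorem logGap_eq_zero {d : ℕ} {x y : ℝ} (hx : 0 < x) (hy : 0 < y) :
    logGap d (x * (1 + y) ^ d) (y * (1 + x) ^ d) (1 + y) = 0 :=
  (logGap_eq_zero_iff (by positivity) (by positivity) (by linarith)).2 (profileSign_eq_zero x y)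

theorem gapSlope_fixedPoint (d : ℕ) (r : ℝ) :
    gapSlope d (r * (1 + r) ^ d) (1 + r) =
      (1 + r) ^ d * (((d - 1) * r - 1) * ((d + 1) * r + 1)) := by
  rw [gapSlope]
  ring

/-- λ_c is the value of r(1+r)^d at r = 1/(d-1), the positive zero of the factorised `gapSlope` at
1+r. A larger activity forces r > 1/(d-1), where `gapSlope` is positive. -/
theorem exists_fixedPoint {d : ℕ} (hd : 2 ≤ d) {lam : ℝ} (hl : lambdaC (d + 1) < lam) :
    ∃ r, 0 < r ∧ lam = r * (1 + r) ^ d ∧ 0 < gapSlope d lam (1 + r) := by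
  have hd1 : (0 : ℝ) < d - 1 := by
    have : (2 : ℝ) ≤ d := by exact_mod_cast hd
    linarith
  have hc : lambdaC (d + 1) = 1 / ((d : ℝ) - 1) * (1 + 1 / ((d : ℝ) - 1)) ^ d := by
    rw [lambdaC, Nat.add_sub_cancel]
    push_cast
    rw [show (d : ℝ) + 1 - 1 = d by ring, show (d : ℝ) + 1 - 2 = d - 1 by ring,
      show 1 + 1 / ((d : ℝ) - 1) = d / (d - 1) by field_simp; ring, div_pow, pow_succ]
    field_simp
  have hl0 : 0 < lam := lt_trans (by rw [hc]; positivity) hl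
  obtain ⟨r, hr, hr'⟩ := intermediate_value_Icc hl0.le
    (f := fun x : ℝ => x * (1 + x) ^ d) (by fun_prop)
    (show lam ∈ Set.Icc _ _ from ⟨by simpa using hl0.le,
      le_mul_of_one_le_right hl0.le (one_le_pow₀ (by linarith))⟩)
  simp only at hr'
  have hrd : 1 / ((d : ℝ) - 1) < r := by
    by_contra! h
    have h0 := hr.1
    refine absurd hl (not_lt.2 ?_)
    rw [hc, ← hr']
    gcongr
  have hr0 : 0 < r := lt_trans (by positivity) hrd
  refine ⟨r, hr0, hr'.symm, ?_⟩
  rw [← hr', gapSlope_fixedPoint]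
  have : 0 < (d - 1) * r - 1 := by
    rw [div_lt_iff₀ hd1] at hrd
    linarith
  positivity

theorem odds_step_lt {d : ℕ} (hd : d ≠ 0) {lam s t : ℝ} (hl : 0 < lam) (hs : 0 < s) (h : s < t) :
    lam / (1 + t) ^ d < lam / (1 + s) ^ d :=
  div_lt_div_of_pos_left hl (by positivity)
    (pow_lt_pow_left₀ (by linarith) (by linarith) hd)

/-- The odds at even and at odd depth converge to a cycle of period two, on both sides of the
fixed point. -/
theorem exists_tendsto_odds {d : ℕ} (hd : 2 ≤ d) {lam : ℝ} (hl : lambdaC (d + 1) < lam) :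
    ∃ x y r, 0 < y ∧ y < r ∧ r < x ∧ lam = x * (1 + y) ^ d ∧ lam = y * (1 + x) ^ d ∧
      lam = r * (1 + r) ^ d ∧ 0 < gapSlope d lam (1 + r) ∧
      Tendsto (fun n => odds d lam (2 * n)) atTop (𝓝 x) ∧
      Tendsto (fun n => odds d lam (2 * n + 1)) atTop (𝓝 y) := by
  obtain ⟨r, hr0, hr, hk⟩ := exists_fixedPoint hd hl
  have hd0 : d ≠ 0 := by omega
  have hl0 : 0 < lam := by rw [hr]; positivity
  have hpos := odds_pos d hl0
  have hfr : lam / (1 + r) ^ d = r := by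
    rw [div_eq_iff (by positivity)]
    exact hr
  have hstep : ∀ n, odds d lam (n + 1) = lam / (1 + odds d lam n) ^ d := fun n => rfl
  have hev : ∀ n, r < odds d lam (2 * n) := by
    intro n
    induction n with
    | zero =>
      change r < lam
      rw [← hfr]
      exact div_lt_self hl0 (one_lt_pow₀ (by linarith) hd0)
    | succ n ih =>
      have h1 := odds_step_lt hd0 hl0 hr0 ih
      rw [hfr, ← hstep] at h1
      have h2 := odds_step_lt hd0 hl0 (hpos _) h1
      rwa [hfr, ← hstep] at h2
  have hdec : ∀ n, odds d lam (2 * (n + 1)) < odds d lam (2 * n) := by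
    intro n
    induction n with
    | zero =>
      change odds d lam (1 + 1) < lam
      rw [hstep]
      exact div_lt_self hl0 (one_lt_pow₀ (by linarith [hpos 1]) hd0)
    | succ n ih =>
      have h1 := odds_step_lt hd0 hl0 (hpos _) ih
      have h2 := odds_step_lt hd0 hl0 (by have := hpos (2 * n); positivity) h1
      exact h2
  have hinc : ∀ n, odds d lam (2 * n + 1) < odds d lam (2 * (n + 1) + 1) := fun n =>
    odds_step_lt hd0 hl0 (hpos _) (hdec n)
  have hbdd : BddBelow (Set.range fun n => odds d lam (2 * n)) :=
    ⟨r, by rintro _ ⟨n, rfl⟩; exact (hev n).le⟩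
  have hx := tendsto_atTop_ciInf (antitone_nat_of_succ_le fun n => (hdec n).le) hbdd
  set x := ⨅ n, odds d lam (2 * n) with hxdef
  have hrx : r ≤ x := le_ciInf fun n => (hev n).le
  have hx0 : 0 < x := hr0.trans_le hrx
  have hlim : ∀ {u : ℕ → ℝ} {t : ℝ}, 0 < t → Tendsto u atTop (𝓝 t) →
      Tendsto (fun n => lam / (1 + u n) ^ d) atTop (𝓝 (lam / (1 + t) ^ d)) := fun ht hu =>
    tendsto_const_nhds.div ((hu.const_add 1).pow d) (by positivity)
  set y := lam / (1 + x) ^ d with hy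
  have hy0 : 0 < y := by positivity
  have hyt : Tendsto (fun n => odds d lam (2 * n + 1)) atTop (𝓝 y) := hlim hx0 hx
  have hxy : x = lam / (1 + y) ^ d :=
    tendsto_nhds_unique ((tendsto_add_atTop_iff_nat 1).2 hx) (hlim hy0 hyt)
  -- If x = r, the odd odds increase to r as well. Close to r, `logGap` is increasing, hence
  -- nonpositive just below 1+r. There `profileSign` ≤ 0 says that two steps of the recursion do not
  -- increase the odds, a contradiction.
  have hne : r ≠ x := by
    intro h
    have hyr : y = r := by rw [hy, ← h, hfr]
    rw [hyr] at hyt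
    have hcont : ContinuousAt (gapSlope d lam) (1 + r) := by
      unfold gapSlope
      fun_prop
    obtain ⟨n, hn⟩ := ((hcont.tendsto.comp (hyt.const_add 1)).eventually
      (lt_mem_nhds hk)).exists
    simp only [Function.comp_apply] at hn
    have ho := hpos (2 * n + 1)
    have hor : odds d lam (2 * n + 1) < r := by
      have h1 := odds_step_lt hd0 hl0 hr0 (hev n)
      rwa [hfr] at h1
    have h1 := monotoneOn_logGap (l₂ := lam) (by omega) hl0
      (show 1 < 1 + odds d lam (2 * n + 1) by linarith) hn.le hk.le
      ⟨le_rfl, by linarith⟩ ⟨by linarith, le_rfl⟩ (by linarith)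
    have h2 := logGap_eq_zero (d := d) hr0 hr0
    rw [← hr] at h2
    rw [h2, ← profileSign_nonpos_iff hl0 hl0 (by linarith)] at h1
    have h3 := hinc n
    rw [show 2 * (n + 1) + 1 = 2 * n + 1 + 1 + 1 by ring, hstep (2 * n + 1 + 1),
      hstep (2 * n + 1)] at h3
    rw [profileSign] at h1
    generalize odds d lam (2 * n + 1) = o at *
    have e : lam / (1 + lam / (1 + o) ^ d) ^ d =
        lam * (1 + o) ^ (d * d) / ((1 + o) ^ d + lam) ^ d := by
      rw [show 1 + lam / (1 + o) ^ d = ((1 + o) ^ d + lam) / (1 + o) ^ d by field_simp, div_pow,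
        ← pow_mul, div_div_eq_mul_div]
    rw [e, lt_div_iff₀ (by positivity)] at h3
    rw [add_sub_cancel_left] at h1
    linarith
  have hrx' : r < x := lt_of_le_of_ne hrx hne
  refine ⟨x, y, r, hy0, ?_, hrx', ?_, ?_, hr, hk, hx, hyt⟩
  · have h1 := odds_step_lt hd0 hl0 hr0 hrx'
    rwa [hfr] at h1
  · rw [eq_div_iff (by positivity)] at hxy
    exact hxy.symm
  · rw [hy, div_mul_cancel₀ _ (by positivity)]

/-- The root of the regular tree has d+1 subtrees instead of d, so its limiting odds are x/(1+y)
rather than x. -/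
theorem tendsto_rootMarginal {d : ℕ} {lam x y : ℝ} (hl0 : 0 < lam) (hx : 0 < x) (hy : 0 < y)
    (hxy : lam = x * (1 + y) ^ d) {u : ℕ → ℕ}
    (hu : Tendsto (fun n => odds d lam (u n)) atTop (𝓝 y)) :
    Tendsto (fun n => rootMarginal (d + 1) lam (u n + 1)) atTop (𝓝 (x / (1 + x + y))) := by
  simp only [rootMarginal_succ _ hl0, Nat.add_sub_cancel]
  have h1 : Tendsto (fun n => lam / (1 + odds d lam (u n)) ^ (d + 1)) atTop
      (𝓝 (lam / (1 + y) ^ (d + 1))) :=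
    tendsto_const_nhds.div ((hu.const_add 1).pow _) (by positivity)
  have h2 := h1.div (h1.const_add 1) (by positivity)
  have e : lam / (1 + y) ^ (d + 1) = x / (1 + y) := by
    rw [hxy, pow_succ]
    field_simp
  have e' : x / (1 + y) / (1 + x / (1 + y)) = x / (1 + x + y) := by
    field_simp
    ring
  rwa [e, e'] at h2

/-! ### A hypercontractive inequality for the edge measure -/

/-- The hypercontractive inequality for the edge measure with weights `1 - α - β`, `α`, `β`, for
the densities `(ξ₀, ξ₁)`, `(η₀, η₁)` with respect to its marginals such that
`q₀ * ξ₀ ≤ q₁ * ξ₁`. -/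
def HyperBound (d : ℕ) (α β q₀ q₁ : ℝ) : Prop :=
  ∀ ξ₀ ξ₁ η₀ η₁ : ℝ, 0 ≤ ξ₀ → 0 ≤ ξ₁ → 0 ≤ η₀ → 0 ≤ η₁ → q₀ * ξ₀ ≤ q₁ * ξ₁ →
    (1 - α) * ξ₀ + α * ξ₁ = 1 → (1 - β) * η₀ + β * η₁ = 1 →
    (1 - α - β) * (ξ₀ ^ ((d : ℝ) / (d + 1)) * η₀ ^ ((d : ℝ) / (d + 1))) +
      α * (ξ₁ ^ ((d : ℝ) / (d + 1)) * η₀ ^ ((d : ℝ) / (d + 1))) +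
      β * (ξ₀ ^ ((d : ℝ) / (d + 1)) * η₁ ^ ((d : ℝ) / (d + 1))) ≤ 1

theorem exists_root (d : ℕ) {ξ : ℝ} (hξ : 0 ≤ ξ) :
    ∃ a : ℝ, 0 ≤ a ∧ a ^ (d + 1) = ξ ∧ a ^ d = ξ ^ ((d : ℝ) / (d + 1)) := by
  refine ⟨ξ ^ (1 / ((d : ℝ) + 1)), by positivity, ?_, ?_⟩
  · rw [← Real.rpow_natCast, ← Real.rpow_mul hξ]
    push_cast
    rw [one_div_mul_cancel (by positivity), Real.rpow_one]
  · rw [← Real.rpow_natCast, ← Real.rpow_mul hξ, one_div_mul_eq_div]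

theorem profile_eq {d : ℕ} {x y : ℝ} (hx : 0 < x) (hy : 0 < y) :
    profile d (x * (1 + y) ^ d) (y * (1 + x) ^ d) (1 + y) =
      (1 + y) ^ d * (1 + x) ^ d * (1 + x + y) / (1 + x + y) ^ d := by
  rw [profile, show (1 + y) ^ d + x * (1 + y) ^ d = (1 + y) ^ d * (1 + x) by ring,
    show (1 + y) ^ (d + 1) + x * (1 + y) ^ d = (1 + y) ^ d * (1 + x + y) by ring,
    div_eq_div_iff (by positivity) (by positivity)]
  simp only [mul_pow]
  ring

/-- The substitution A = (1+y)a, E = (1+x)e turns the two norms into multiples of the expectations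
of the densities, and the constant `profile` at 1+y is the one that gives equality when all
densities are 1. -/
theorem hyperBound_of_edgeForm {d : ℕ} {x y q₀ q₁ : ℝ} (hx : 0 < x) (hy : 0 < y)
    (h : ∀ A B E C : ℝ, 0 ≤ A → 0 ≤ B → 0 ≤ E → 0 ≤ C → q₀ * A ^ (d + 1) ≤ q₁ * B ^ (d + 1) →
      edgeForm d (x * (1 + y) ^ d) (y * (1 + x) ^ d) A B E C ^ (d + 1) ≤
        profile d (x * (1 + y) ^ d) (y * (1 + x) ^ d) (1 + y) *
          (A ^ (d + 1) + x * (1 + y) ^ d * B ^ (d + 1)) ^ d *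
          (E ^ (d + 1) + y * (1 + x) ^ d * C ^ (d + 1)) ^ d) :
    HyperBound d (x / (1 + x + y)) (y / (1 + x + y)) (q₀ * (1 + y) ^ (d + 1)) q₁ := by
  intro ξ₀ ξ₁ η₀ η₁ h0 h1 h2 h3 hq hξ hη
  obtain ⟨a, ha, ha1, ha2⟩ := exists_root d h0
  obtain ⟨b, hb, hb1, hb2⟩ := exists_root d h1
  obtain ⟨e, he, he1, he2⟩ := exists_root d h2
  obtain ⟨c, hc, hc1, hc2⟩ := exists_root d h3
  rw [← ha2, ← hb2, ← he2, ← hc2]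
  have hS : 0 < 1 + x + y := by positivity
  have key := h ((1 + y) * a) b ((1 + x) * e) c (by positivity) hb (by positivity) hc
    (by rw [mul_pow, ha1, hb1, ← mul_assoc]; exact hq)
  set T := (1 - x / (1 + x + y) - y / (1 + x + y)) * (a ^ d * e ^ d) +
    x / (1 + x + y) * (b ^ d * e ^ d) + y / (1 + x + y) * (a ^ d * c ^ d) with hT
  have e1 : edgeForm d (x * (1 + y) ^ d) (y * (1 + x) ^ d) ((1 + y) * a) b ((1 + x) * e) c =
      (1 + x) ^ d * (1 + y) ^ d * (1 + x + y) * T := by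
    rw [edgeForm, hT]
    simp only [mul_pow]
    field_simp
    ring
  have e2 : ((1 + y) * a) ^ (d + 1) + x * (1 + y) ^ d * b ^ (d + 1) =
      (1 + y) ^ d * (1 + x + y) := by
    rw [mul_pow, ha1, hb1]
    field_simp at hξ
    linear_combination (1 + y) ^ d * hξ
  have e3 : ((1 + x) * e) ^ (d + 1) + y * (1 + x) ^ d * c ^ (d + 1) =
      (1 + x) ^ d * (1 + x + y) := by
    rw [mul_pow, he1, hc1]
    field_simp at hη
    linear_combination (1 + x) ^ d * hη
  rw [e1, e2, e3, profile_eq hx hy] at key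
  have e4 : (1 + y) ^ d * (1 + x) ^ d * (1 + x + y) / (1 + x + y) ^ d *
      ((1 + y) ^ d * (1 + x + y)) ^ d * ((1 + x) ^ d * (1 + x + y)) ^ d =
      ((1 + x) ^ d * (1 + y) ^ d * (1 + x + y)) ^ (d + 1) := by
    rw [div_mul_eq_mul_div, div_mul_eq_mul_div, div_eq_iff (by positivity)]
    simp only [mul_pow]
    ring
  rw [e4, mul_pow _ T] at key
  have h5 : T ^ (d + 1) ≤ 1 := by
    refine le_of_mul_le_mul_left ?_
      (show 0 < ((1 + x) ^ d * (1 + y) ^ d * (1 + x + y)) ^ (d + 1) by positivity)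
    rwa [mul_one]
  by_contra! h6
  exact absurd h5 (not_le.2 (one_lt_pow₀ h6 (by omega)))

theorem midpoint_rpow_lt {s a b : ℝ} (hs0 : 0 < s) (hs1 : s < 1) (ha : 0 ≤ a) (hb : 0 ≤ b)
    (hab : a ≠ b) : (a ^ s + b ^ s) / 2 < ((a + b) / 2) ^ s := by
  have h := (Real.strictConcaveOn_rpow hs0 hs1).2 (show a ∈ Set.Ici 0 from ha)
    (show b ∈ Set.Ici 0 from hb) hab (show (0 : ℝ) < 1 / 2 by norm_num)
    (show (0 : ℝ) < 1 / 2 by norm_num) (by norm_num)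
  simp only [smul_eq_mul] at h
  rw [show 1 / 2 * a + 1 / 2 * b = (a + b) / 2 by ring] at h
  linarith

theorem midpoint_rpow_le {s a b : ℝ} (hs0 : 0 < s) (hs1 : s < 1) (ha : 0 ≤ a) (hb : 0 ≤ b) :
    (a ^ s + b ^ s) / 2 ≤ ((a + b) / 2) ^ s := by
  rcases eq_or_ne a b with rfl | hab
  · rw [add_self_div_two, add_self_div_two]
  · exact (midpoint_rpow_lt hs0 hs1 ha hb hab).le

theorem exponent_pos {d : ℕ} (hd : 1 ≤ d) : 0 < (d : ℝ) / (d + 1) := by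
  have : (1 : ℝ) ≤ d := by exact_mod_cast hd
  positivity

theorem exponent_lt_one (d : ℕ) : (d : ℝ) / (d + 1) < 1 := by
  rw [div_lt_one (by positivity)]
  linarith

/-- For given `(η₀, η₁)`, equality holds in the hypercontractive inequality at most once. -/
theorem HyperBound.unique_left {d : ℕ} (hd : 1 ≤ d) {α β q₀ q₁ : ℝ}
    (h : HyperBound d α β q₀ q₁) (hα : 0 < α) (hβ : 0 < β) (hαβ : 0 < 1 - α - β)
    {ξ₀ ξ₁ ζ₀ ζ₁ η₀ η₁ : ℝ} (hξ₀ : 0 ≤ ξ₀) (hξ₁ : 0 ≤ ξ₁) (hζ₀ : 0 ≤ ζ₀) (hζ₁ : 0 ≤ ζ₁)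
    (hη₀ : 0 ≤ η₀) (hη₁ : 0 ≤ η₁) (hqξ : q₀ * ξ₀ ≤ q₁ * ξ₁) (hqζ : q₀ * ζ₀ ≤ q₁ * ζ₁)
    (hξ : (1 - α) * ξ₀ + α * ξ₁ = 1) (hζ : (1 - α) * ζ₀ + α * ζ₁ = 1)
    (hη : (1 - β) * η₀ + β * η₁ = 1)
    (e1 : 1 ≤ (1 - α - β) * (ξ₀ ^ ((d : ℝ) / (d + 1)) * η₀ ^ ((d : ℝ) / (d + 1))) +
      α * (ξ₁ ^ ((d : ℝ) / (d + 1)) * η₀ ^ ((d : ℝ) / (d + 1))) +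
      β * (ξ₀ ^ ((d : ℝ) / (d + 1)) * η₁ ^ ((d : ℝ) / (d + 1))))
    (e2 : 1 ≤ (1 - α - β) * (ζ₀ ^ ((d : ℝ) / (d + 1)) * η₀ ^ ((d : ℝ) / (d + 1))) +
      α * (ζ₁ ^ ((d : ℝ) / (d + 1)) * η₀ ^ ((d : ℝ) / (d + 1))) +
      β * (ζ₀ ^ ((d : ℝ) / (d + 1)) * η₁ ^ ((d : ℝ) / (d + 1)))) : ξ₀ = ζ₀ := by
  by_contra hne
  -- All constraints on the densities are linear and hence hold at the midpoint; there strict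
  -- concavity of t^s would push the left side above 1.
  have hm := h ((ξ₀ + ζ₀) / 2) ((ξ₁ + ζ₁) / 2) η₀ η₁ (by positivity) (by positivity) hη₀ hη₁
    (by linarith) (by linarith) hη
  have hs0 := exponent_pos hd
  have hs1 := exponent_lt_one d
  have m0 := midpoint_rpow_lt hs0 hs1 hξ₀ hζ₀ hne
  have m1 := midpoint_rpow_le hs0 hs1 hξ₁ hζ₁
  have n0 : 0 ≤ η₀ ^ ((d : ℝ) / (d + 1)) := by positivity
  have n1 : 0 ≤ η₁ ^ ((d : ℝ) / (d + 1)) := by positivity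
  have hc : 0 < (1 - α - β) * η₀ ^ ((d : ℝ) / (d + 1)) + β * η₁ ^ ((d : ℝ) / (d + 1)) := by
    rcases hη₀.eq_or_lt with hz | hz
    · have : 0 < η₁ := by
        rw [← hz] at hη
        exact pos_of_mul_pos_right (a := β) (by linarith) hβ.le
      have := Real.rpow_pos_of_pos this ((d : ℝ) / (d + 1))
      have := mul_nonneg hαβ.le n0
      positivity
    · have := Real.rpow_pos_of_pos hz ((d : ℝ) / (d + 1))
      positivity
  have h1 := mul_lt_mul_of_pos_left m0 hc
  have h2 := mul_le_mul_of_nonneg_left m1 (mul_nonneg hα.le n0)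
  linarith

/-- For given `(ξ₀, ξ₁)`, equality holds in the hypercontractive inequality at most once. -/
theorem HyperBound.unique_right {d : ℕ} (hd : 1 ≤ d) {α β q₀ q₁ : ℝ}
    (h : HyperBound d α β q₀ q₁) (hα : 0 < α) (hαβ : 0 < 1 - α - β) (hβ : 0 < β)
    {ξ₀ ξ₁ ζ₀ ζ₁ η₀ η₁ : ℝ} (hξ₀ : 0 ≤ ξ₀) (hξ₁ : 0 ≤ ξ₁) (hζ₀ : 0 ≤ ζ₀) (hζ₁ : 0 ≤ ζ₁)
    (hη₀ : 0 ≤ η₀) (hη₁ : 0 ≤ η₁) (hqξ : q₀ * ξ₀ ≤ q₁ * ξ₁)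
    (hξ : (1 - α) * ξ₀ + α * ξ₁ = 1) (hζ : (1 - β) * ζ₀ + β * ζ₁ = 1)
    (hη : (1 - β) * η₀ + β * η₁ = 1)
    (e1 : 1 ≤ (1 - α - β) * (ξ₀ ^ ((d : ℝ) / (d + 1)) * η₀ ^ ((d : ℝ) / (d + 1))) +
      α * (ξ₁ ^ ((d : ℝ) / (d + 1)) * η₀ ^ ((d : ℝ) / (d + 1))) +
      β * (ξ₀ ^ ((d : ℝ) / (d + 1)) * η₁ ^ ((d : ℝ) / (d + 1))))
    (e2 : 1 ≤ (1 - α - β) * (ξ₀ ^ ((d : ℝ) / (d + 1)) * ζ₀ ^ ((d : ℝ) / (d + 1))) +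
      α * (ξ₁ ^ ((d : ℝ) / (d + 1)) * ζ₀ ^ ((d : ℝ) / (d + 1))) +
      β * (ξ₀ ^ ((d : ℝ) / (d + 1)) * ζ₁ ^ ((d : ℝ) / (d + 1)))) : η₀ = ζ₀ := by
  by_contra hne
  have hm := h ξ₀ ξ₁ ((η₀ + ζ₀) / 2) ((η₁ + ζ₁) / 2) hξ₀ hξ₁ (by positivity) (by positivity)
    hqξ hξ (by linarith)
  have hs0 := exponent_pos hd
  have hs1 := exponent_lt_one d
  have m0 := midpoint_rpow_lt hs0 hs1 hη₀ hζ₀ hne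
  have m1 := midpoint_rpow_le hs0 hs1 hη₁ hζ₁
  have n0 : 0 ≤ ξ₀ ^ ((d : ℝ) / (d + 1)) := by positivity
  have n1 : 0 ≤ ξ₁ ^ ((d : ℝ) / (d + 1)) := by positivity
  have hc : 0 < (1 - α - β) * ξ₀ ^ ((d : ℝ) / (d + 1)) + α * ξ₁ ^ ((d : ℝ) / (d + 1)) := by
    rcases hξ₀.eq_or_lt with hz | hz
    · have : 0 < ξ₁ := by
        rw [← hz] at hξ
        exact pos_of_mul_pos_right (a := α) (by linarith) hα.le
      have := Real.rpow_pos_of_pos this ((d : ℝ) / (d + 1))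
      have := mul_nonneg hαβ.le n0
      positivity
    · have := Real.rpow_pos_of_pos hz ((d : ℝ) / (d + 1))
      positivity
  have h1 := mul_lt_mul_of_pos_left m0 hc
  have h2 := mul_le_mul_of_nonneg_left m1 (mul_nonneg hβ.le n0)
  linarith

/-! ### Gibbs' inequality for the second moment exponent -/

/-- This is ln t ≤ t - 1 at t = Q/c with its equality case, arranged so that c = 0 is allowed. -/
theorem mul_log_sub_le {c Q : ℝ} (hc : 0 ≤ c) (hQ : 0 ≤ Q) (h : c ≠ 0 → 0 < Q) :
    c * Real.log Q - c * Real.log c ≤ Q - c ∧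
      (c * Real.log Q - c * Real.log c = Q - c → c = Q) := by
  rcases hc.eq_or_lt with rfl | hc
  · exact ⟨by simpa using hQ, fun h => by simpa using h⟩
  have hQ := h hc.ne'
  have e : c * Real.log Q - c * Real.log c = c * Real.log (Q / c) := by
    rw [Real.log_div hQ.ne' hc.ne']
    ring
  have e' : Q - c = c * (Q / c - 1) := by field_simp
  rw [e, e']
  refine ⟨mul_le_mul_of_nonneg_left (Real.log_le_sub_one_of_pos (by positivity)) hc.le, fun h => ?_⟩
  by_contra hne
  have hne' : Q / c ≠ 1 := fun h => hne ((div_eq_one_iff_eq hc.ne').1 h).symm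
  exact (mul_lt_mul_of_pos_left (Real.log_lt_sub_one_of_pos (by positivity) hne') hc).ne h

/-- Gibbs' inequality for a cell of the edge distribution: `c` is the mass of the cell, `μ` and
`ν` are the masses of the types of its end points and `u` and `v` their reference masses. -/
theorem cell_le {s c μ ν u v p q : ℝ} (hc : 0 ≤ c) (hμ : c ≤ μ) (hν : c ≤ ν) (hu : 0 < u)
    (hv : 0 < v) (hp : 0 < p) (hq : 0 < q) :
    ∃ L, L = c * (Real.log p + Real.log q +
        s * (Real.log μ - Real.log u + (Real.log ν - Real.log v))) - c * Real.log c ∧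
      L ≤ p * q * ((μ / u) ^ s * (ν / v) ^ s) - c ∧
      (L = p * q * ((μ / u) ^ s * (ν / v) ^ s) - c →
        c = p * q * ((μ / u) ^ s * (ν / v) ^ s)) := by
  have hμ0 : 0 ≤ μ := hc.trans hμ
  have hν0 : 0 ≤ ν := hc.trans hν
  have e : c * (Real.log p + Real.log q +
      s * (Real.log μ - Real.log u + (Real.log ν - Real.log v))) =
      c * Real.log (p * q * ((μ / u) ^ s * (ν / v) ^ s)) := by
    rcases hc.eq_or_lt with rfl | hc
    · simp
    have hμ0 : 0 < μ := hc.trans_le hμ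
    have hν0 : 0 < ν := hc.trans_le hν
    rw [Real.log_mul (by positivity) (by positivity), Real.log_mul hp.ne' hq.ne',
      Real.log_mul (by positivity) (by positivity), Real.log_rpow (by positivity),
      Real.log_rpow (by positivity), Real.log_div hμ0.ne' hu.ne', Real.log_div hν0.ne' hv.ne']
    ring
  refine ⟨_, rfl, ?_⟩
  rw [e]
  refine mul_log_sub_le hc (by positivity) fun h => ?_
  have hc := hc.lt_of_ne' h
  have hμ0 : 0 < μ := hc.trans_le hμ
  have hν0 : 0 < ν := hc.trans_le hν
  positivity

/-- The entropy of the product of two splittings of the same mass. -/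
theorem exists_product_coupling {r b u t : ℝ} (hr : 0 ≤ r) (hb : 0 ≤ b) (hu : 0 ≤ u) (ht : 0 ≤ t)
    (h : r + b = u + t) : ∃ p, 0 ≤ p ∧ 0 ≤ u - p ∧ 0 ≤ r - p ∧ 0 ≤ t - r + p ∧
      p * Real.log p + (u - p) * Real.log (u - p) + (r - p) * Real.log (r - p) +
          (t - r + p) * Real.log (t - r + p) =
        r * Real.log r + b * Real.log b + u * Real.log u + t * Real.log t -
          (r + b) * Real.log (r + b) := by
  have hw0 : 0 ≤ r + b := by positivity
  rcases hw0.eq_or_lt with hw | hw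
  · obtain rfl : r = 0 := by linarith
    obtain rfl : b = 0 := by linarith
    obtain rfl : u = 0 := by linarith
    obtain rfl : t = 0 := by linarith
    exact ⟨0, by simp⟩
  have key : ∀ {x y : ℝ}, 0 ≤ x → 0 ≤ y → x * y / (r + b) * Real.log (x * y / (r + b)) =
      x * y / (r + b) * (Real.log x + Real.log y - Real.log (r + b)) := by
    intro x y hx hy
    rcases hx.eq_or_lt with rfl | hx
    · simp
    rcases hy.eq_or_lt with rfl | hy
    · simp
    rw [Real.log_div (by positivity) hw.ne', Real.log_mul hx.ne' hy.ne']
  have e2 : u - r * u / (r + b) = b * u / (r + b) := by field_simp; ring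
  have e3 : r - r * u / (r + b) = r * t / (r + b) := by
    field_simp
    linear_combination r * h
  have e4 : t - r + r * u / (r + b) = b * t / (r + b) := by
    field_simp
    linear_combination -r * h
  refine ⟨r * u / (r + b), by positivity, by rw [e2]; positivity, by rw [e3]; positivity,
    by rw [e4]; positivity, ?_⟩
  rw [e2, e3, e4, key hr hu, key hb hu, key hr ht, key hb ht]
  have f1 : r * u / (r + b) + r * t / (r + b) = r := by
    field_simp
    linear_combination -r * h
  have f2 : b * u / (r + b) + b * t / (r + b) = b := by
    field_simp
    linear_combination -b * h
  have f3 : r * u / (r + b) + b * u / (r + b) = u := by field_simp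
  have f4 : r * t / (r + b) + b * t / (r + b) = t := by field_simp
  linear_combination (Real.log r - Real.log (r + b)) * f1 + (Real.log b - Real.log (r + b)) * f2 +
    Real.log u * f3 + Real.log t * f4

/-- In terms of t ln t the vertex types carry the factor D-1 and the edge cells the factor D. The
convention 0 ln 0 = 0 makes this an identity for all real arguments. -/
theorem Phi₂_eq (D : ℕ) (lam α β γ δ ε : ℝ) :
    Phi₂ D lam α β γ δ ε = 2 * (α + β) * Real.log lam +
      ((D : ℝ) - 1) * (γ * Real.log γ + 2 * ((α - γ) * Real.log (α - γ)) +
        (1 - 2 * α + γ) * Real.log (1 - 2 * α + γ) + δ * Real.log δ +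
        2 * ((β - δ) * Real.log (β - δ)) +
        (1 - 2 * β + δ) * Real.log (1 - 2 * β + δ)) -
      D * (γ * Real.log γ + ε * Real.log ε +
        (1 - 2 * β + δ - γ - ε) * Real.log (1 - 2 * β + δ - γ - ε) +
        (α - γ - ε) * Real.log (α - γ - ε) +
        (β - δ + ε + γ - α) * Real.log (β - δ + ε + γ - α) +
        (α - γ) * Real.log (α - γ) + (1 - α - β - ε) * Real.log (1 - α - β - ε) +
        (β - δ) * Real.log (β - δ) -
        (1 - β - γ - ε) * Real.log (1 - β - γ - ε) + δ * Real.log δ) := by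
  rw [Phi₂]
  simp only [H, H₁]
  rw [show 1 - α - (α - γ) = 1 - 2 * α + γ by ring, show 1 - β - (β - δ) = 1 - 2 * β + δ by ring,
    show 1 - γ - (α - γ) = 1 - α by ring, show β - δ - (α - γ - ε) = β - δ + ε + γ - α by ring,
    show 1 - β - γ - ε - (α - γ) = 1 - α - β - ε by ring]
  ring

theorem Phi₂_product (D : ℕ) (lam : ℝ) {α β : ℝ} (hα : 0 < α) (hβ : 0 < β)
    (hαβ : 0 < 1 - α - β) :
    Phi₂ D lam α β (α ^ 2) (β ^ 2) (α * (1 - α - β)) = 2 * (α + β) * Real.log lam +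
      ((D : ℝ) - 1) * (2 * (α * Real.log α + (1 - α) * Real.log (1 - α) + β * Real.log β +
        (1 - β) * Real.log (1 - β))) -
      D * (2 * (α * Real.log α + β * Real.log β + (1 - α - β) * Real.log (1 - α - β))) := by
  have h1 : 0 < 1 - α := by linarith
  have h2 : 0 < 1 - β := by linarith
  rw [Phi₂_eq, show α - α ^ 2 = α * (1 - α) by ring, show β - β ^ 2 = β * (1 - β) by ring,
    show 1 - 2 * α + α ^ 2 = (1 - α) ^ 2 by ring, show 1 - 2 * β + β ^ 2 = (1 - β) ^ 2 by ring,
    show (1 - β) ^ 2 - α ^ 2 - α * (1 - α - β) = (1 - β) * (1 - α - β) by ring,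
    show α * (1 - α) - α * (1 - α - β) = α * β by ring,
    show β * (1 - β) + α * (1 - α - β) + α ^ 2 - α = β * (1 - α - β) by ring,
    show 1 - α - β - α * (1 - α - β) = (1 - α) * (1 - α - β) by ring,
    show 1 - β - α ^ 2 - α * (1 - α - β) = (1 - α) * (1 - β) by ring]
  simp only [Real.log_pow, Real.log_mul hα.ne' h1.ne', Real.log_mul hβ.ne' h2.ne',
    Real.log_mul hα.ne' hβ.ne', Real.log_mul hα.ne' hαβ.ne', Real.log_mul hβ.ne' hαβ.ne',
    Real.log_mul h2.ne' hαβ.ne', Real.log_mul h1.ne' hαβ.ne', Real.log_mul h1.ne' h2.ne']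
  push_cast
  ring

theorem product_mem_feasible {α β : ℝ} (hα : 0 < α) (hβ : 0 < β) (hαβ : 0 < 1 - α - β) :
    (α ^ 2, β ^ 2, α * (1 - α - β)) ∈ feasible α β := by
  have h1 : 0 < 1 - α := by linarith
  have h2 : 0 < 1 - β := by linarith
  refine ⟨by positivity, by positivity, by positivity, ?_, ?_, ?_, ?_, ?_⟩
  · rw [show α - α ^ 2 - α * (1 - α - β) = α * β by ring]
    positivity
  · rw [show β - β ^ 2 = β * (1 - β) by ring]
    positivity
  · rw [show 1 - 2 * β + β ^ 2 - α ^ 2 - α * (1 - α - β) = (1 - β) * (1 - α - β) by ring]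
    positivity
  · rw [show 1 - α - β - α * (1 - α - β) = (1 - α) * (1 - α - β) by ring]
    positivity
  · rw [show β - β ^ 2 + α * (1 - α - β) + α ^ 2 - α = β * (1 - α - β) by ring]
    positivity

/-- Where the conditional densities satisfy the side condition of a hypercontractive inequality,
`Φ₂` is smaller than at the product point. -/
theorem Phi₂_lt_product {d : ℕ} (hd : 1 ≤ d) (lam : ℝ) {α β q₀ q₁ γ δ ε : ℝ} (hα : 0 < α)
    (hβ : 0 < β) (hαβ : 0 < 1 - α - β) (hyp : HyperBound d α β q₀ q₁)
    (hmem : (γ, δ, ε) ∈ feasible α β)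
    (hq1 : q₀ * ((α - γ) / (α * (1 - α))) ≤ q₁ * (γ / (α * α)))
    (hq0 : q₀ * ((1 - 2 * α + γ) / ((1 - α) * (1 - α))) ≤ q₁ * ((α - γ) / (α * (1 - α))))
    (hne : (γ, δ, ε) ≠ (α ^ 2, β ^ 2, α * (1 - α - β))) :
    Phi₂ (d + 1) lam α β γ δ ε < Phi₂ (d + 1) lam α β (α ^ 2) (β ^ 2) (α * (1 - α - β)) := by
  obtain ⟨f1, f2, f3, f4, f5, f6, f7, f8⟩ := hmem
  have h1 : 0 < 1 - α := by linarith
  have h2 : 0 < 1 - β := by linarith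
  have hs : (d : ℝ) / (d + 1) * (d + 1) = d := div_mul_cancel₀ _ (by positivity)
  have hl00 : 0 ≤ 1 - 2 * α + γ := by linarith
  -- `Phi₂` records the edges at ends occupied only in the second copy through one binomial entropy.
  -- The coupling splits this block into four cells, bringing the number of cells to nine.
  obtain ⟨p, p1, p2, p3, p4, hp⟩ := exists_product_coupling f6 f5
    (show 0 ≤ α - γ by linarith) f7 (by ring)
  rw [show 1 - 2 * β + δ - γ - ε + (β - δ) = 1 - β - γ - ε by ring] at hp
  set s := (d : ℝ) / (d + 1) with hsdef
  have la : Real.log (α * α) = 2 * Real.log α := by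
    rw [Real.log_mul hα.ne' hα.ne']; ring
  have la' : Real.log (α * (1 - α)) = Real.log α + Real.log (1 - α) :=
    Real.log_mul hα.ne' h1.ne'
  have la'' : Real.log ((1 - α) * (1 - α)) = 2 * Real.log (1 - α) := by
    rw [Real.log_mul h1.ne' h1.ne']; ring
  have lb : Real.log (β * β) = 2 * Real.log β := by
    rw [Real.log_mul hβ.ne' hβ.ne']; ring
  have lb' : Real.log (β * (1 - β)) = Real.log β + Real.log (1 - β) :=
    Real.log_mul hβ.ne' h2.ne'
  have lb'' : Real.log ((1 - β) * (1 - β)) = 2 * Real.log (1 - β) := by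
    rw [Real.log_mul h2.ne' h2.ne']; ring
  obtain ⟨L1, e1, i1, k1⟩ := cell_le (s := s) (c := γ) (μ := γ) (ν := 1 - 2 * β + δ) f1 le_rfl (by linarith)
    (mul_pos hα hα) (mul_pos h2 h2) hα hα
  obtain ⟨L2, e2, i2, k2⟩ := cell_le (s := s) (c := ε) (μ := α - γ) (ν := 1 - 2 * β + δ) f3 (by linarith)
    (by linarith) (mul_pos hα h1) (mul_pos h2 h2) hα hαβ
  obtain ⟨L3, e3, i3, k3⟩ := cell_le (s := s) (c := α - γ - ε) (μ := α - γ) (ν := β - δ) f4 (by linarith)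
    (by linarith) (mul_pos hα h1) (mul_pos hβ h2) hα hβ
  obtain ⟨L4, e4, i4, k4⟩ := cell_le (s := s) (c := p) (μ := α - γ) (ν := 1 - 2 * β + δ) p1 (by linarith)
    (by linarith) (mul_pos hα h1) (mul_pos h2 h2) hαβ hα
  obtain ⟨L5, e5, i5, k5⟩ := cell_le (s := s) (c := α - γ - p) (μ := α - γ) (ν := β - δ) p2 (by linarith)
    (by linarith) (mul_pos hα h1) (mul_pos hβ h2) hβ hα
  obtain ⟨L6, e6, i6, k6⟩ := cell_le (s := s) (c := 1 - 2 * β + δ - γ - ε - p) (μ := 1 - 2 * α + γ) (ν := 1 - 2 * β + δ) p3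
    (by linarith) (by linarith) (mul_pos h1 h1) (mul_pos h2 h2) hαβ hαβ
  obtain ⟨L7, e7, i7, k7⟩ := cell_le (s := s) (c := 1 - α - β - ε - (1 - 2 * β + δ - γ - ε) + p) (μ := 1 - 2 * α + γ) (ν := β - δ) p4
    (by linarith) (by linarith) (mul_pos h1 h1) (mul_pos hβ h2) hβ hαβ
  obtain ⟨L8, e8, i8, k8⟩ := cell_le (s := s) (c := β - δ + ε + γ - α) (μ := 1 - 2 * α + γ) (ν := β - δ) f8
    (by linarith) (by linarith) (mul_pos h1 h1) (mul_pos hβ h2) hαβ hβ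
  obtain ⟨L9, e9, i9, k9⟩ := cell_le (s := s) (c := δ) (μ := 1 - 2 * α + γ) (ν := δ) f2
    (by linarith) le_rfl (mul_pos h1 h1) (mul_pos hβ hβ) hβ hβ
  -- The terms in λ cancel, and d = (d+1)s turns the vertex entropies into the exponents s of the
  -- cells.
  have key : Phi₂ (d + 1) lam α β γ δ ε - Phi₂ (d + 1) lam α β (α ^ 2) (β ^ 2) (α * (1 - α - β)) =
      ((d : ℝ) + 1) * (L1 + L2 + L3 + L4 + L5 + L6 + L7 + L8 + L9) := by
    rw [Phi₂_eq, Phi₂_product _ _ hα hβ hαβ, e1, e2, e3, e4, e5, e6, e7, e8, e9, la, la', la'',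
      lb, lb', lb'']
    push_cast
    linear_combination ((d : ℝ) + 1) * hp - (γ * Real.log γ + 2 * ((α - γ) * Real.log (α - γ)) +
      (1 - 2 * α + γ) * Real.log (1 - 2 * α + γ) + δ * Real.log δ +
      2 * ((β - δ) * Real.log (β - δ)) + (1 - 2 * β + δ) * Real.log (1 - 2 * β + δ) -
      2 * (α * Real.log α + (1 - α) * Real.log (1 - α) + β * Real.log β +
        (1 - β) * Real.log (1 - β))) * hs
  clear e1 e2 e3 e4 e5 e6 e7 e8 e9 la la' la'' lb lb' lb'' hp k1 k3 k4 k5 k6 k7 k8 k9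
  set ξ₀₀ := (1 - 2 * α + γ) / ((1 - α) * (1 - α)) with hξ₀₀
  set ξ₁₀ := (α - γ) / (α * (1 - α)) with hξ₁₀
  set ξ₁₁ := γ / (α * α) with hξ₁₁
  set η₀₀ := (1 - 2 * β + δ) / ((1 - β) * (1 - β)) with hη₀₀
  set η₁₀ := (β - δ) / (β * (1 - β)) with hη₁₀
  set η₁₁ := δ / (β * β) with hη₁₁
  have nξ₀₀ : 0 ≤ ξ₀₀ := div_nonneg hl00 (by positivity)
  have nξ₁₀ : 0 ≤ ξ₁₀ := div_nonneg (by linarith) (by positivity)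
  have nξ₁₁ : 0 ≤ ξ₁₁ := div_nonneg f1 (by positivity)
  have nη₀₀ : 0 ≤ η₀₀ := div_nonneg (by linarith) (by positivity)
  have nη₁₀ : 0 ≤ η₁₀ := div_nonneg f5 (by positivity)
  have nη₁₁ : 0 ≤ η₁₁ := div_nonneg f2 (by positivity)
  have mξ₀ : (1 - α) * ξ₀₀ + α * ξ₁₀ = 1 := by
    rw [hξ₀₀, hξ₁₀]; field_simp; ring
  have mξ₁ : (1 - α) * ξ₁₀ + α * ξ₁₁ = 1 := by
    rw [hξ₁₀, hξ₁₁]; field_simp; ring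
  have mη₀ : (1 - β) * η₀₀ + β * η₁₀ = 1 := by
    rw [hη₀₀, hη₁₀]; field_simp; ring
  have mη₁ : (1 - β) * η₁₀ + β * η₁₁ = 1 := by
    rw [hη₁₀, hη₁₁]; field_simp; ring
  -- Each bound fixes the edge state in one copy and sums over the edge in the other; the marginal
  -- conditions make the conditional densities admissible.
  have b00 := hyp ξ₀₀ ξ₁₀ η₀₀ η₁₀ nξ₀₀ nξ₁₀ nη₀₀ nη₁₀ hq0 mξ₀ mη₀
  have b10 := hyp ξ₁₀ ξ₁₁ η₀₀ η₁₀ nξ₁₀ nξ₁₁ nη₀₀ nη₁₀ hq1 mξ₁ mη₀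
  have b01 := hyp ξ₀₀ ξ₁₀ η₁₀ η₁₁ nξ₀₀ nξ₁₀ nη₁₀ nη₁₁ hq0 mξ₀ mη₁
  have u1 := hyp.unique_left hd hα hβ hαβ nξ₀₀ nξ₁₀ nξ₁₀ nξ₁₁ nη₀₀ nη₁₀ hq0 hq1 mξ₀ mξ₁ mη₀
  have u2 := hyp.unique_right hd hα hαβ hβ nξ₀₀ nξ₁₀ nη₁₀ nη₁₁ nη₀₀ nη₁₀ hq0 mξ₀ mη₁ mη₀
  rw [← hsdef] at b00 b10 b01 u1 u2
  have w00 := mul_le_mul_of_nonneg_left b00 hαβ.le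
  have w10 := mul_le_mul_of_nonneg_left b10 hα.le
  have w01 := mul_le_mul_of_nonneg_left b01 hβ.le
  by_contra! hcon
  -- The sum is also at most ΣQ - Σc ≤ 1 - 1, so every inequality above is an equality.
  have hL : 0 ≤ L1 + L2 + L3 + L4 + L5 + L6 + L7 + L8 + L9 :=
    nonneg_of_mul_nonneg_right (a := (d : ℝ) + 1) (by linarith) (by positivity)
  have hξ : ξ₀₀ = ξ₁₀ := u1 (le_of_mul_le_mul_left (by linarith) hαβ)
    (le_of_mul_le_mul_left (by linarith) hα)
  have hη : η₀₀ = η₁₀ := u2 (le_of_mul_le_mul_left (by linarith) hαβ)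
    (le_of_mul_le_mul_left (by linarith) hβ)
  -- The densities determine γ and δ; ε is read off from equality in its own cell.
  have hε := k2 (by linarith)
  have hξ1 : ξ₁₀ = 1 := by rw [hξ] at mξ₀; linarith
  have hη1 : η₀₀ = 1 := by rw [← hη] at mη₀; linarith
  have hη2 : η₁₀ = 1 := hη.symm.trans hη1
  rw [hξ1, hη1, Real.one_rpow, mul_one, mul_one] at hε
  rw [hξ₁₀, div_eq_one_iff_eq (by positivity)] at hξ1
  rw [hη₁₀, div_eq_one_iff_eq (by positivity)] at hη2
  refine hne ?_
  rw [hε, show γ = α ^ 2 by linarith, show δ = β ^ 2 by linarith]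

/-! ### Hypercontractivity at and near the limits -/

theorem hyperBound_of_cycle {d : ℕ} (hd : 1 ≤ d) {lam x y r : ℝ} (hy : 0 < y) (hyr : y < r)
    (hrx : r < x) (hx1 : lam = x * (1 + y) ^ d) (hy1 : lam = y * (1 + x) ^ d)
    (hr1 : lam = r * (1 + r) ^ d) (hk : 0 < gapSlope d lam (1 + r)) :
    HyperBound d (x / (1 + x + y)) (y / (1 + x + y)) 0 0 ∧
      ∃ c, 1 + y < c ∧ c < 1 + r ∧ gapSlope d lam c < 0 := by
  have hr : 0 < r := hy.trans hyr
  have hx : 0 < x := hr.trans hrx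
  have hl : 0 < lam := by rw [hr1]; positivity
  have g0 := logGap_eq_zero (d := d) hx hy
  rw [← hx1, ← hy1] at g0
  have gr := logGap_eq_zero (d := d) hr hr
  rw [← hr1] at gr
  obtain ⟨⟨c, hc1, hc2, hc⟩, hneg⟩ := logGap_between_zeros hd hl (show 1 < 1 + y by linarith)
    (show 1 + y < 1 + r by linarith) g0 gr hk
  constructor
  · have hN : ∀ A, 0 ≤ A → A ≤ 1 + r → profile d lam lam A ≤ profile d lam lam (1 + y) := by
      intro A hA hA'
      refine profile_le hd hl hl (by linarith) (fun A h1 h2 => ?_) hneg hA hA'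
      rw [← g0]
      exact antitoneOn_logGap hd hl hc2.le hc.le hk ⟨h1, h2.trans hc1.le⟩
        ⟨by linarith, hc1.le⟩ h2
    have := hyperBound_of_edgeForm (d := d) (q₀ := 0) (q₁ := 0) hx hy (by
      intro A B E C hA hB hE hC _
      rw [← hx1, ← hy1]
      exact edgeForm_pow_le_of_fixedPoint hd hr hr1 hN hA hB hE hC)
    rwa [zero_mul] at this
  -- Halfway between 1+y and a zero of `gapSlope`, concavity gives strict negativity, which survives
  -- a change of activity.
  · refine ⟨(1 + y + c) / 2, by linarith, by linarith, ?_⟩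
    by_contra! h
    set m := (1 + y + c) / 2 with hm
    have hms : 0 < 1 + r - m := by linarith
    have hcc := (concaveOn_gapSlope d lam).2 (show m ∈ Set.Ici 0 from Set.mem_Ici.2 (by linarith))
      (show 1 + r ∈ Set.Ici 0 from Set.mem_Ici.2 (by linarith))
      (show 0 ≤ (1 + r - c) / (1 + r - m) from div_nonneg (by linarith) hms.le)
      (show 0 ≤ (c - m) / (1 + r - m) from div_nonneg (by linarith) hms.le)
      (by rw [← add_div]; exact (div_eq_one_iff_eq hms.ne').2 (by ring))
    simp only [smul_eq_mul] at hcc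
    have e : (1 + r - c) / (1 + r - m) * m + (c - m) / (1 + r - m) * (1 + r) = c := by
      field_simp
      ring
    rw [e, hc] at hcc
    have h1 : 0 ≤ (1 + r - c) / (1 + r - m) * gapSlope d lam m :=
      mul_nonneg (div_nonneg (by linarith) hms.le) h
    have h2 : 0 < (c - m) / (1 + r - m) * gapSlope d lam (1 + r) :=
      mul_pos (div_pos (by linarith) hms) hk
    linarith

/-- Up to c, `logGap` decreases through its zero at 1+y, so no relation between the two activities
is needed. The side condition says A ≤ cB after the substitution, and at the constant density 1 it
holds strictly. -/
theorem hyperBound_local {d : ℕ} (hd : 1 ≤ d) {x y c s : ℝ} (hx : 0 < x) (hy : 0 < y)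
    (hyc : 1 + y < c) (hcs : c ≤ s) (hc : gapSlope d (x * (1 + y) ^ d) c ≤ 0)
    (hs : 0 < gapSlope d (x * (1 + y) ^ d) s) :
    HyperBound d (x / (1 + x + y)) (y / (1 + x + y)) ((1 + y) ^ (d + 1)) (c ^ (d + 1)) := by
  have h1 : 0 < x * (1 + y) ^ d := by positivity
  have h2 : 0 < y * (1 + x) ^ d := by positivity
  have hc0 : 0 < c := by linarith
  have g0 := logGap_eq_zero (d := d) hx hy
  have hanti := antitoneOn_logGap (l₂ := y * (1 + x) ^ d) hd h1 hcs hc hs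
  have hy1 : 1 + y ∈ Set.Ioc 1 c := ⟨by linarith, hyc.le⟩
  have hN : ∀ A, 0 ≤ A → A ≤ c → profile d (x * (1 + y) ^ d) (y * (1 + x) ^ d) A ≤
      profile d (x * (1 + y) ^ d) (y * (1 + x) ^ d) (1 + y) := by
    intro A hA hA'
    refine profile_le hd h1 h2 (by linarith) (fun A h1 h2 => ?_) (fun A h1 h2 => ?_) hA hA'
    · rw [← g0]
      exact hanti ⟨h1, h2.trans hyc.le⟩ hy1 h2
    · rw [← g0]
      exact hanti hy1 ⟨by linarith, h2⟩ h1
  have := hyperBound_of_edgeForm (d := d) (q₀ := 1) (q₁ := c ^ (d + 1)) hx hy (by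
    intro A B E C hA hB hE hC hq
    rw [one_mul, ← mul_pow] at hq
    exact edgeForm_pow_le_of_profile_le hd h1 h2 hN hA hB hE hC
      (le_of_pow_le_pow_left₀ (by omega) (by positivity) hq))
  rwa [one_mul] at this

/-! ### Compactness -/

theorem continuous_Phi₂ (D : ℕ) (lam : ℝ) : Continuous fun z : (ℝ × ℝ) × (ℝ × ℝ × ℝ) =>
    Phi₂ D lam z.1.1 z.1.2 z.2.1 z.2.2.1 z.2.2.2 := by
  have h : ∀ x : ℝ, x * Real.log x = -Real.negMulLog x := fun x => by
    rw [Real.negMulLog]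
    ring
  simp only [Phi₂_eq, h]
  fun_prop

theorem isClosed_feasible :
    IsClosed {z : (ℝ × ℝ) × (ℝ × ℝ × ℝ) | z.2 ∈ feasible z.1.1 z.1.2} := by
  have h : {z : (ℝ × ℝ) × (ℝ × ℝ × ℝ) | z.2 ∈ feasible z.1.1 z.1.2} =
      {z | 0 ≤ z.2.1} ∩ ({z | 0 ≤ z.2.2.1} ∩ ({z | 0 ≤ z.2.2.2} ∩
        ({z | 0 ≤ z.1.1 - z.2.1 - z.2.2.2} ∩ ({z | 0 ≤ z.1.2 - z.2.2.1} ∩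
          ({z | 0 ≤ 1 - 2 * z.1.2 + z.2.2.1 - z.2.1 - z.2.2.2} ∩
            ({z | 0 ≤ 1 - z.1.1 - z.1.2 - z.2.2.2} ∩
              {z | 0 ≤ z.1.2 - z.2.2.1 + z.2.2.2 + z.2.1 - z.1.1})))))) := rfl
  rw [h]
  repeat' apply IsClosed.inter
  all_goals exact isClosed_le (by fun_prop) (by fun_prop)

theorem continuous_Phi₂_product (D : ℕ) (lam : ℝ) :
    Continuous fun z : (ℝ × ℝ) × (ℝ × ℝ × ℝ) =>
      Phi₂ D lam z.1.1 z.1.2 (z.1.1 ^ 2) (z.1.2 ^ 2) (z.1.1 * (1 - z.1.1 - z.1.2)) := by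
  have h : Continuous fun z : (ℝ × ℝ) × (ℝ × ℝ × ℝ) =>
      (z.1, (z.1.1 ^ 2, z.1.2 ^ 2, z.1.1 * (1 - z.1.1 - z.1.2))) := by fun_prop
  exact (continuous_Phi₂ D lam).comp h

theorem mem_Icc_of_mem_feasible {α β : ℝ} (hα : 0 ≤ α) (hβ : 0 ≤ β) (hαβ : 0 ≤ 1 - α - β)
    {y : ℝ × ℝ × ℝ} (hy : y ∈ feasible α β) :
    y ∈ Set.Icc ((0 : ℝ), (0 : ℝ), (0 : ℝ)) (1, 1, 1) := by
  obtain ⟨γ, δ, ε⟩ := y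
  obtain ⟨f1, f2, f3, f4, f5, -⟩ := hy
  simp only [Set.mem_Icc, Prod.mk_le_mk]
  exact ⟨⟨f1, f2, f3⟩, by linarith, by linarith, by linarith⟩

/-- A strict inequality between continuous functions off a graph persists under perturbation of the
first argument if it does so near the graph. -/
theorem eventually_forall_lt {X Y : Type*} [TopologicalSpace X] [TopologicalSpace Y]
    {F G : X × Y → ℝ} (hF : Continuous F) (hG : Continuous G) {S : Set (X × Y)} (hS : IsClosed S)
    {K : Set Y} (hK : IsCompact K) {m : X → Y} {x₀ : X}
    (h0 : ∀ y, (x₀, y) ∈ S → y ≠ m x₀ → F (x₀, y) < G (x₀, y))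
    (hloc : ∀ᶠ z in 𝓝 (x₀, m x₀), z ∈ S → z.2 ≠ m z.1 → F z < G z) :
    ∀ᶠ x in 𝓝 x₀, ∀ y ∈ K, (x, y) ∈ S → y ≠ m x → F (x, y) < G (x, y) := by
  refine hK.eventually_forall_of_forall_eventually fun y _ => ?_
  by_cases hy : (x₀, y) ∈ S
  · by_cases hne : y = m x₀
    · rw [hne]
      exact hloc
    · exact (hF.continuousAt.eventually_lt hG.continuousAt (h0 y hy hne)).mono fun z hz _ _ => hz
  · filter_upwards [hS.isOpen_compl.mem_nhds hy] with z hz h using absurd h hz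

/-- A unique maximum at the product point persists under perturbation of `(α, β)` if it does so
locally. -/
theorem eventually_isUniqueMaxOn {D : ℕ} {lam α₀ β₀ : ℝ} (hα : 0 < α₀) (hβ : 0 < β₀)
    (hαβ : 0 < 1 - α₀ - β₀)
    (h0 : ∀ y ∈ feasible α₀ β₀, y ≠ (α₀ ^ 2, β₀ ^ 2, α₀ * (1 - α₀ - β₀)) →
      Phi₂ D lam α₀ β₀ y.1 y.2.1 y.2.2 <
        Phi₂ D lam α₀ β₀ (α₀ ^ 2) (β₀ ^ 2) (α₀ * (1 - α₀ - β₀)))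
    (hloc : ∀ᶠ z : (ℝ × ℝ) × (ℝ × ℝ × ℝ) in
      𝓝 ((α₀, β₀), (α₀ ^ 2, β₀ ^ 2, α₀ * (1 - α₀ - β₀))), z.2 ∈ feasible z.1.1 z.1.2 →
        z.2 ≠ (z.1.1 ^ 2, z.1.2 ^ 2, z.1.1 * (1 - z.1.1 - z.1.2)) →
        Phi₂ D lam z.1.1 z.1.2 z.2.1 z.2.2.1 z.2.2.2 <
          Phi₂ D lam z.1.1 z.1.2 (z.1.1 ^ 2) (z.1.2 ^ 2) (z.1.1 * (1 - z.1.1 - z.1.2))) :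
    ∀ᶠ p : ℝ × ℝ in 𝓝 (α₀, β₀),
      IsUniqueMaxOn (fun x : ℝ × ℝ × ℝ => Phi₂ D lam p.1 p.2 x.1 x.2.1 x.2.2) (feasible p.1 p.2)
        (p.1 ^ 2, p.2 ^ 2, p.1 * (1 - p.1 - p.2)) := by
  have hall := eventually_forall_lt (continuous_Phi₂ D lam) (continuous_Phi₂_product D lam)
    isClosed_feasible (isCompact_Icc (a := ((0 : ℝ), (0 : ℝ), (0 : ℝ))) (b := (1, 1, 1)))
    (m := fun p : ℝ × ℝ => (p.1 ^ 2, p.2 ^ 2, p.1 * (1 - p.1 - p.2))) (x₀ := (α₀, β₀)) h0 hloc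
  have e1 : ∀ᶠ p : ℝ × ℝ in 𝓝 (α₀, β₀), 0 < p.1 :=
    continuousAt_fst.eventually (lt_mem_nhds hα)
  have e2 : ∀ᶠ p : ℝ × ℝ in 𝓝 (α₀, β₀), 0 < p.2 :=
    continuousAt_snd.eventually (lt_mem_nhds hβ)
  have e3 : ∀ᶠ p : ℝ × ℝ in 𝓝 (α₀, β₀), 0 < 1 - p.1 - p.2 :=
    (show Continuous fun p : ℝ × ℝ => 1 - p.1 - p.2 by fun_prop).continuousAt.eventually
      (lt_mem_nhds hαβ)
  filter_upwards [hall, e1, e2, e3] with p hp h1 h2 h3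
  refine ⟨product_mem_feasible h1 h2 h3, fun y hy hne =>
    hp y (mem_Icc_of_mem_feasible h1.le h2.le h3.le hy) hy hne⟩

/-- The points c and s stay fixed while the activities vary with (α, β): the signs of `gapSlope`
there are open conditions, and so are the side conditions, because all densities equal 1 at the
product point. -/
theorem eventually_local {d : ℕ} (hd : 1 ≤ d) {lam x y c s : ℝ} (hx : 0 < x) (hy : 0 < y)
    (hx1 : lam = x * (1 + y) ^ d) (hyc : 1 + y < c) (hcs : c ≤ s) (hc : gapSlope d lam c < 0)
    (hs : 0 < gapSlope d lam s) {α₀ β₀ : ℝ} (hα : α₀ = x / (1 + x + y))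
    (hβ : β₀ = y / (1 + x + y)) :
    ∀ᶠ z : (ℝ × ℝ) × (ℝ × ℝ × ℝ) in
      𝓝 ((α₀, β₀), (α₀ ^ 2, β₀ ^ 2, α₀ * (1 - α₀ - β₀))), z.2 ∈ feasible z.1.1 z.1.2 →
        z.2 ≠ (z.1.1 ^ 2, z.1.2 ^ 2, z.1.1 * (1 - z.1.1 - z.1.2)) →
        Phi₂ (d + 1) lam z.1.1 z.1.2 z.2.1 z.2.2.1 z.2.2.2 <
          Phi₂ (d + 1) lam z.1.1 z.1.2 (z.1.1 ^ 2) (z.1.2 ^ 2)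
            (z.1.1 * (1 - z.1.1 - z.1.2)) := by
  have hS : 0 < 1 + x + y := by positivity
  have hτ : 1 - α₀ - β₀ = 1 / (1 + x + y) := by
    rw [hα, hβ]
    field_simp
    ring
  have hα0 : 0 < α₀ := by rw [hα]; positivity
  have hβ0 : 0 < β₀ := by rw [hβ]; positivity
  have hτ0 : 0 < 1 - α₀ - β₀ := by rw [hτ]; positivity
  have hα1 : 0 < 1 - α₀ := by linarith
  have hxx : α₀ / (1 - α₀ - β₀) = x := by
    rw [hτ, hα]
    field_simp
  have hyy : β₀ / (1 - α₀ - β₀) = y := by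
    rw [hτ, hβ]
    field_simp
  set z₀ : (ℝ × ℝ) × (ℝ × ℝ × ℝ) := ((α₀, β₀), (α₀ ^ 2, β₀ ^ 2, α₀ * (1 - α₀ - β₀))) with hz₀
  have cτ : ContinuousAt (fun z : (ℝ × ℝ) × (ℝ × ℝ × ℝ) => 1 - z.1.1 - z.1.2) z₀ := by fun_prop
  have cα : ContinuousAt (fun z : (ℝ × ℝ) × (ℝ × ℝ × ℝ) => z.1.1) z₀ := by fun_prop
  have cβ : ContinuousAt (fun z : (ℝ × ℝ) × (ℝ × ℝ × ℝ) => z.1.2) z₀ := by fun_prop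
  have cγ : ContinuousAt (fun z : (ℝ × ℝ) × (ℝ × ℝ × ℝ) => z.2.1) z₀ := by fun_prop
  have cx : ContinuousAt (fun z : (ℝ × ℝ) × (ℝ × ℝ × ℝ) => z.1.1 / (1 - z.1.1 - z.1.2)) z₀ :=
    cα.div cτ hτ0.ne'
  have cy : ContinuousAt (fun z : (ℝ × ℝ) × (ℝ × ℝ × ℝ) => 1 + z.1.2 / (1 - z.1.1 - z.1.2)) z₀ :=
    continuousAt_const.add (cβ.div cτ hτ0.ne')
  have cl : ContinuousAt (fun z : (ℝ × ℝ) × (ℝ × ℝ × ℝ) => z.1.1 / (1 - z.1.1 - z.1.2) *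
      (1 + z.1.2 / (1 - z.1.1 - z.1.2)) ^ d) z₀ := cx.mul (cy.pow d)
  have cg : ∀ t, ContinuousAt (fun z : (ℝ × ℝ) × (ℝ × ℝ × ℝ) => gapSlope d
      (z.1.1 / (1 - z.1.1 - z.1.2) * (1 + z.1.2 / (1 - z.1.1 - z.1.2)) ^ d) t) z₀ := by
    intro t
    unfold gapSlope
    exact (((continuousAt_const.mul cl).mul continuousAt_const).sub
      (continuousAt_const.mul cl)).sub continuousAt_const
  have c11 : ContinuousAt (fun z : (ℝ × ℝ) × (ℝ × ℝ × ℝ) => z.2.1 / (z.1.1 * z.1.1)) z₀ :=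
    cγ.div (cα.mul cα) (mul_pos hα0 hα0).ne'
  have c10 : ContinuousAt (fun z : (ℝ × ℝ) × (ℝ × ℝ × ℝ) =>
      (z.1.1 - z.2.1) / (z.1.1 * (1 - z.1.1))) z₀ :=
    (cα.sub cγ).div (cα.mul (continuousAt_const.sub cα)) (mul_pos hα0 hα1).ne'
  have c00 : ContinuousAt (fun z : (ℝ × ℝ) × (ℝ × ℝ × ℝ) =>
      (1 - 2 * z.1.1 + z.2.1) / ((1 - z.1.1) * (1 - z.1.1))) z₀ :=
    ((continuousAt_const.sub (continuousAt_const.mul cα)).add cγ).div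
      ((continuousAt_const.sub cα).mul (continuousAt_const.sub cα)) (mul_pos hα1 hα1).ne'
  have v11 : α₀ ^ 2 / (α₀ * α₀) = 1 := by field_simp
  have v10 : (α₀ - α₀ ^ 2) / (α₀ * (1 - α₀)) = 1 := by field_simp
  have v00 : (1 - 2 * α₀ + α₀ ^ 2) / ((1 - α₀) * (1 - α₀)) = 1 := by field_simp; ring
  have hpow : (1 + y) ^ (d + 1) < c ^ (d + 1) :=
    pow_lt_pow_left₀ hyc (by positivity) (by omega)
  have n1 := cα.eventually (lt_mem_nhds hα0)
  have n2 := cβ.eventually (lt_mem_nhds hβ0)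
  have n3 := cτ.eventually (lt_mem_nhds hτ0)
  have n4 := cy.eventually_lt (continuousAt_const (y := c)) (by simpa only [hz₀, hyy] using hyc)
  have n5 := (cg c).eventually_lt (continuousAt_const (y := (0 : ℝ)))
    (by simpa only [hz₀, hyy, hxx, ← hx1] using hc)
  have n6 := (continuousAt_const (y := (0 : ℝ))).eventually_lt (cg s)
    (by simpa only [hz₀, hyy, hxx, ← hx1] using hs)
  have n7 := ((cy.pow (d + 1)).mul c10).eventually_lt
    ((continuousAt_const (y := c ^ (d + 1))).mul c11)
    (by simpa only [hz₀, Pi.mul_apply, Pi.pow_apply, hyy, v10, v11, mul_one] using hpow)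
  have n8 := ((cy.pow (d + 1)).mul c00).eventually_lt
    ((continuousAt_const (y := c ^ (d + 1))).mul c10)
    (by simpa only [hz₀, Pi.mul_apply, Pi.pow_apply, hyy, v10, v00, mul_one] using hpow)
  filter_upwards [n1, n2, n3, n4, n5, n6, n7, n8] with z m1 m2 m3 m4 m5 m6 m7 m8 hmem hne
  obtain ⟨⟨α, β⟩, γ, δ, ε⟩ := z
  simp only at m1 m2 m3 m4 m5 m6 m7 m8 hmem hne ⊢
  have hyp := hyperBound_local hd (div_pos m1 m3) (div_pos m2 m3) m4 hcs m5.le m6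
  have hsum : 1 + α / (1 - α - β) + β / (1 - α - β) = 1 / (1 - α - β) := by
    field_simp
    ring
  rw [hsum, div_div_div_cancel_right₀ m3.ne', div_div_div_cancel_right₀ m3.ne', div_one,
    div_one] at hyp
  exact Phi₂_lt_product hd lam m1 m2 m3 hyp hmem m7.le m8.le hne

/-! ### The second moment condition above the threshold λ_c -/

theorem slyCondition {d : ℕ} (hd : 2 ≤ d) {lam : ℝ} (hl : lambdaC (d + 1) < lam) :
    SlyCondition (d + 1) lam := by
  obtain ⟨x, y, r, hy, hyr, hrx, hx1, hy1, hr1, hk, hev, hodd⟩ := exists_tendsto_odds hd hl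
  have hr : 0 < r := hy.trans hyr
  have hx : 0 < x := hr.trans hrx
  have hl0 : 0 < lam := by rw [hr1]; positivity
  have hd1 : 1 ≤ d := by omega
  obtain ⟨hyp, c, hc1, hc2, hc⟩ := hyperBound_of_cycle hd1 hy hyr hrx hx1 hy1 hr1 hk
  have hα : 0 < x / (1 + x + y) := by positivity
  have hβ : 0 < y / (1 + x + y) := by positivity
  have hαβ : 0 < 1 - x / (1 + x + y) - y / (1 + x + y) := by
    rw [show 1 - x / (1 + x + y) - y / (1 + x + y) = 1 / (1 + x + y) by field_simp; ring]
    positivity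
  refine ⟨x / (1 + x + y), y / (1 + x + y), ?_, ?_, ?_⟩
  -- A tree of positive even depth has subtrees of odd depth, whose odds tend to y; depth 0 is
  -- skipped by the shift.
  · rw [← tendsto_add_atTop_iff_nat 1]
    exact tendsto_rootMarginal hl0 hx hy hx1 hodd
  · have h := tendsto_rootMarginal hl0 hy hx hy1 hev
    rwa [show 1 + y + x = 1 + x + y by ring] at h
  · have h := eventually_isUniqueMaxOn (D := d + 1) (lam := lam) hα hβ hαβ
      (fun z hz hne => Phi₂_lt_product hd1 lam hα hβ hαβ hyp hz (by simp) (by simp) hne)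
      (eventually_local hd1 hx hy hx1 hc1 hc2.le hc hk rfl rfl)
    obtain ⟨χ, hχ, h⟩ := Metric.eventually_nhds_iff.1 h
    refine ⟨χ, hχ, fun α β h1 h2 => h (y := (α, β)) ?_⟩
    rw [Prod.dist_eq, max_lt_iff, dist_comm, Real.dist_eq, dist_comm, Real.dist_eq]
    exact ⟨h1, h2⟩

end HardCore

end

theorem lemma3 :
    (∀ lam : ℝ, HardCore.lambdaC 3 < lam → HardCore.SlyCondition 3 lam) ∧
    (∀ (D : ℕ) (lam : ℝ), 3 < D → HardCore.lambdaC D < lam → lam ≤ HardCore.lambdaHalf D →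
      HardCore.SlyCondition D lam) := by
  refine ⟨fun lam h => HardCore.slyCondition (d := 2) le_rfl h, fun D lam hD h _ => ?_⟩
  obtain ⟨d, rfl⟩ : ∃ d, D = d + 1 := ⟨D - 1, by omega⟩
  exact HardCore.slyCondition (by omega) h
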